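/- **Setting.** Let $\Omega$ be a finite or countable set with probabilities $(\pi_\omega)$, $I,J\ge 1$, and let $\|\cdot\|$ be the Euclidean norm. For each $\omega$ let $\mathcal X_\omega\subset\mathbb R^I$ be closed and bounded, let $\mathcal C$ be a closed bounded set containing $\bigcup_\omega\mathcal X_\omega$, and let $f,g_1,\dots,g_J$ be real functions, convex on $\mathrm{conv}\,\mathcal C$. Put $\overline{\mathcal X}=\sum_\omega\pi_\omega\,\mathrm{conv}\,\mathcal X_\omega$ and let $\mathcal Y\supseteq\overline{\mathcal X}$ be closed, bounded and convex. Assume that $f,g_j$ are convex on $\mathcal Y$ and Lipschitz with constants $M_f,M_{gj}>0$ on $\mathcal Y\cup\mathrm{conv}(\bigcup_\omega\mathcal X_\omega)$, and that some $\hat x$ in the interior of $\overline{\mathcal X}$ has $g_j(\hat x)<0$ for all $j$. States $\omega(0),\omega(1),\dots$ are i.i.d. with law $\pi$, and $\omega(t)$ is independent of all states and decisions of earlier slots. Let $f^{(\mathrm{opt})}$ be the infimum of $\limsup_T f(\bar x(T))$, $\bar x(T)=\frac1T\sum_{t<T}\mathbb E[x(t)]$, over all (randomized, non-anticipating) policies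 with $x(t)\in\mathcal X_{\omega(t)}$ and $\limsup_T g_j(\bar x(T))\le 0$ for all $j$. Let $C=\sup_{x\in\mathcal C,\,y\in\mathcal Y}\frac12\big(\|g(y)\|^2+\|x-y\|^2\big)$. **Algorithm** (drift-plus-penalty, parameter $V>0$). From deterministic $W(0)\in\mathbb R_+^J$ and $Z(0)\in\mathbb R^I$, in each slot choose $x(t)\in\arg\min_{x\in\mathcal X_{\omega(t)}}Z(t)^\top x$ and $y(t)\in\arg\min_{y\in\mathcal Y}[Vf(y)+W(t)^\top g(y)-Z(t)^\top y]$ (ties broken in any non-anticipating way), and set $W(t+1)=[W(t)+g(y(t))]_+$, $Z(t+1)=Z(t)+x(t)-y(t)$. Put $Q(t)=(W(t),Z(t))$ and $\bar x(t_0,T)=\frac1T\sum_{t=t_0}^{t_0+T-1}x(t)$. **Dual function.** For $w\in\mathbb R_+^J$, $z\in\mathbb R^I$ let $d(w,z)=\inf\sum_\omega\pi_\omega\big[f(y)+w^\top g(y)+z^\top(x^\omega-y)\big]$, the infimum over $y\in\mathcal Y$ and $x^\omega\in\mathrm{conv}\,\mathcal X_\omega$ for all $\omega$. Assume that $d$ has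 a unique maximizer $\lambda^*$ over $\mathbb R_+^J\times\mathbb R^I$ and that, for some $S,L_G,L_G'>0$ and all $\lambda\in\mathbb R_+^J\times\mathbb R^I$, $$d(\lambda^*)\ge d(\lambda)+L_G\|\lambda-\lambda^*\|^2\ \text{ if }\|\lambda-\lambda^*\|\le S,\qquad d(\lambda^*)\ge d(\lambda)+L_G'\|\lambda-\lambda^*\|\ \text{ if }\|\lambda-\lambda^*\|>S.$$ **Constants.** Let $$B_G(V)=\max\Big[\tfrac1{\sqrt V},\ \sqrt V\,\tfrac{1+\sqrt{1+4L_GC}}{2L_G}\Big],\quad B_G'=\max\Big[\tfrac{L_G'}2,\tfrac{2C}{L_G'}\Big],\quad r=\tfrac{3}{6C\sqrt V+\sqrt{2C}},\quad \rho=1-\tfrac{3}{12CV+2\sqrt{2CV}},$$ $$D=\frac{e^{rB_G(V)}(e^{r\sqrt{2C}}-\rho)}{1-\rho},\qquad U_G(V)=\frac{\log(D+e^{rB_G(V)})}{r},\qquad U_G'(V)=\frac{2(D+e^{rB_G(V)})}{r^2}.$$ Let $T_G$ be the first $t\ge0$ with $\|Q(t)-V\lambda^*\|<B_G(V)$. A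 bound is said to hold *for $t_0\ge T_G$* if it holds with $\mathbb E$ the expectation when $T_G\le t_0$ almost surely, and also with $\mathbb E$ the conditional expectation given $T_G=s$, for every $s\le t_0$ with $\mathbb P(T_G=s)>0$. **Theorem.** For every $V>0$ with $B_G(V)<SV$, $B_G'\le SV$ and $\sqrt V\ge 2/L_G'$, every $t_0\ge T_G$ and every integer $T\ge1$, the random variables $f(\bar x(t_0,T))$ and $g_j(\bar x(t_0,T))$ are integrable and, with $(U,U')=(U_G(V),U_G'(V))$, $$\mathbb E[f(\bar x(t_0,T))]-f^{(\mathrm{opt})}\le\frac{2M_fU}{T}+\frac{U'+4VU\|\lambda^*\|}{2TV}+\frac CV,\qquad \mathbb E[g_j(\bar x(t_0,T))]\le\frac{2U}{T}+\frac{2M_{gj}U}{T}\quad(1\le j\le J).$$ The same bounds hold with $(U,U')=(\tilde U(V),\tilde U'(V))$ for certain functions $\tilde U,\tilde U'$ of $V$ that are determined by $C$ and $L_G$ alone and satisfy $\tilde U(V)=O(\sqrt V)$ and $\tilde U'(V)=O(V)$ as $V\to\infty$. Consequently there are $c$ and $V_0>0$, depending only on the problem, such that for all $V\ge V_0$, $t_0\ge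 T_G$, $T\ge1$ the objective gap $\mathbb E[f(\bar x(t_0,T))]-f^{(\mathrm{opt})}$ is at most $c(\sqrt V/T+1/V)$ and each $\mathbb E[g_j(\bar x(t_0,T))]$ is at most $c\sqrt V/T$. In particular the convergence time is $O(1/\epsilon^{1.5})$: there are $c$ and $\epsilon_0>0$, depending only on the problem, such that for $0<\epsilon\le\epsilon_0$, $V=1/\epsilon$, $t_0\ge T_G$ and every $T\ge\epsilon^{-3/2}$, the objective gap and each $\mathbb E[g_j(\bar x(t_0,T))]$ are at most $c\,\epsilon$. -/

import Mathlib

open MeasureTheory ProbabilityTheory Filter Topology Asymptotics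

universe u v

noncomputable section

/-- Data of a time-average stochastic optimization problem with countable state space `Ω`,
decision vectors in `ℝ^I` and `J` constraints. -/
structure TAProblem (Ω : Type u) (I J : ℕ) where
  /-- distribution of the random state -/
  prob : PMF Ω
  /-- objective -/
  f : EuclideanSpace ℝ (Fin I) → ℝ
  /-- constraint functions -/
  g : Fin J → EuclideanSpace ℝ (Fin I) → ℝ
  /-- decision set in each state -/
  X : Ω → Set (EuclideanSpace ℝ (Fin I))
  /-- closed bounded set containing all decision sets -/
  box : Set (EuclideanSpace ℝ (Fin I))
  /-- extended set, from which the auxiliary vector is chosen -/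
  Y : Set (EuclideanSpace ℝ (Fin I))

/-- Vectors `(w, z) ∈ ℝ^J × ℝ^I` with the Euclidean norm `√(‖w‖² + ‖z‖²)`. -/
abbrev MultVec (I J : ℕ) : Type :=
  WithLp 2 (EuclideanSpace ℝ (Fin J) × EuclideanSpace ℝ (Fin I))

/-- Concatenation `(w, z)`. -/
def multVec {I J : ℕ} (w : EuclideanSpace ℝ (Fin J)) (z : EuclideanSpace ℝ (Fin I)) :
    MultVec I J := WithLp.toLp 2 (w, z)

/-- `λ = (w, z)` lies in `ℝ_+^J × ℝ^I`. -/
def DualFeasible {I J : ℕ} (l : MultVec I J) : Prop := ∀ j, 0 ≤ l.fst j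

/-- Sigma-algebra generated by the history `h 0, …, h (t-1)`. -/
abbrev pastSigma {Ω' H : Type*} [MeasurableSpace H] (h : ℕ → Ω' → H) (t : ℕ) :
    MeasurableSpace Ω' :=
  ⨆ s ∈ Set.Iio t, MeasurableSpace.comap (h s) inferInstance

/-- The states `st 0, st 1, …` have law `prob`, and the state of slot `t` is independent of
everything that happened before slot `t` (recorded by `h`). When `h` records the states,
this makes them i.i.d. -/
structure IsStateProcess {Ω : Type*} [MeasurableSpace Ω] (prob : PMF Ω)
    {Ω' H : Type*} [MeasurableSpace Ω'] [MeasurableSpace H] (P : Measure Ω')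
    (st : ℕ → Ω' → Ω) (h : ℕ → Ω' → H) : Prop where
  measurable : ∀ t, Measurable (st t)
  law : ∀ t, P.map (st t) = prob.toMeasure
  indep : ∀ t, Indep (MeasurableSpace.comap (st t) inferInstance) (pastSigma h t) P

/-- The `T`-slot average `(1/T) ∑_{t = t₀}^{t₀+T-1} x(t)` along a sample path. -/
def slotAvg {I : ℕ} {Ω' : Type*} (x : ℕ → Ω' → EuclideanSpace ℝ (Fin I)) (t₀ T : ℕ)
    (a : Ω') : EuclideanSpace ℝ (Fin I) :=
  (T : ℝ)⁻¹ • ∑ t ∈ Finset.Ico t₀ (t₀ + T), x t a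

namespace TAProblem

variable {Ω : Type u} {I J : ℕ} (p : TAProblem Ω I J)

/-- Probability of a state, as a real number. -/
def wt (o : Ω) : ℝ := (p.prob o).toReal

/-- `X̄ = ∑_ω π_ω conv(X_ω)`. -/
def Xbar : Set (EuclideanSpace ℝ (Fin I)) :=
  {v | ∃ x : Ω → EuclideanSpace ℝ (Fin I),
    (∀ o, x o ∈ convexHull ℝ (p.X o)) ∧ v = ∑' o, p.wt o • x o}

/-- Standing assumptions on the problem. The Lipschitz bounds are required on the extended set
and on the convex hull of the decision sets, where sample-path averages of decisions live. -/
structure Standing (Mf : ℝ) (Mg : Fin J → ℝ) : Prop where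
  X_closed : ∀ o, IsClosed (p.X o)
  X_bounded : ∀ o, Bornology.IsBounded (p.X o)
  box_closed : IsClosed p.box
  box_bounded : Bornology.IsBounded p.box
  X_subset : ∀ o, p.X o ⊆ p.box
  f_convex : ConvexOn ℝ (convexHull ℝ p.box) p.f
  g_convex : ∀ j, ConvexOn ℝ (convexHull ℝ p.box) (p.g j)
  slater : ∃ x ∈ interior p.Xbar, ∀ j, p.g j x < 0
  Y_closed : IsClosed p.Y
  Y_bounded : Bornology.IsBounded p.Y
  Y_convex : Convex ℝ p.Y
  Xbar_subset : p.Xbar ⊆ p.Y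
  f_convex_Y : ConvexOn ℝ p.Y p.f
  g_convex_Y : ∀ j, ConvexOn ℝ p.Y (p.g j)
  Mf_pos : 0 < Mf
  Mg_pos : ∀ j, 0 < Mg j
  f_lip : ∀ x ∈ p.Y ∪ convexHull ℝ (⋃ o, p.X o), ∀ y ∈ p.Y ∪ convexHull ℝ (⋃ o, p.X o),
    |p.f x - p.f y| ≤ Mf * ‖x - y‖
  g_lip : ∀ j, ∀ x ∈ p.Y ∪ convexHull ℝ (⋃ o, p.X o),
    ∀ y ∈ p.Y ∪ convexHull ℝ (⋃ o, p.X o), |p.g j x - p.g j y| ≤ Mg j * ‖x - y‖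

/-- `C = sup_{x ∈ box, y ∈ Y} (‖g(y)‖² + ‖x - y‖²) / 2`. -/
def driftConst : ℝ :=
  sSup {c | ∃ x ∈ p.box, ∃ y ∈ p.Y, c = (∑ j, p.g j y ^ 2 + ‖x - y‖ ^ 2) / 2}

/-- An admissible policy: in every slot a random decision is taken from the decision set of the
current state; the current state is independent of past states and decisions. -/
structure IsPolicy [MeasurableSpace Ω] {Ω' : Type*} [MeasurableSpace Ω'] (P : Measure Ω')
    (st : ℕ → Ω' → Ω) (x : ℕ → Ω' → EuclideanSpace ℝ (Fin I)) : Prop where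
  states : IsStateProcess p.prob P st (fun t a => (st t a, x t a))
  measurable : ∀ t, Measurable (x t)
  mem : ∀ t a, x t a ∈ p.X (st t a)

/-- `x̄(T) = (1/T) ∑_{t < T} E[x(t)]`. -/
def meanAvg {Ω' : Type*} [MeasurableSpace Ω'] (P : Measure Ω')
    (x : ℕ → Ω' → EuclideanSpace ℝ (Fin I)) (T : ℕ) : EuclideanSpace ℝ (Fin I) :=
  (T : ℝ)⁻¹ • ∑ t ∈ Finset.range T, ∫ a, x t a ∂P

/-- Optimal cost of the time-average problem: the infimum of `limsup_T f(x̄(T))` over admissible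
policies, on arbitrary probability spaces, with `limsup_T g_j(x̄(T)) ≤ 0` for all `j`. -/
def fopt [MeasurableSpace Ω] : ℝ :=
  sInf {c | ∃ (Ω' : Type u) (_ : MeasurableSpace Ω') (P : Measure Ω')
    (st : ℕ → Ω' → Ω) (x : ℕ → Ω' → EuclideanSpace ℝ (Fin I)),
    IsProbabilityMeasure P ∧ p.IsPolicy P st x ∧
    (∀ j, limsup (fun T => p.g j (meanAvg P x T)) atTop ≤ 0) ∧
    c = limsup (fun T => p.f (meanAvg P x T)) atTop}

/-- The Lagrangian of the embedded problem. -/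
def lagrangian (x : Ω → EuclideanSpace ℝ (Fin I)) (y : EuclideanSpace ℝ (Fin I))
    (l : MultVec I J) : ℝ :=
  ∑' o, p.wt o * (p.f y + ∑ j, l.fst j * p.g j y + inner ℝ l.snd (x o - y))

/-- The dual function of the embedded problem. -/
def dual (l : MultVec I J) : ℝ :=
  sInf {c | ∃ (x : Ω → EuclideanSpace ℝ (Fin I)) (y : EuclideanSpace ℝ (Fin I)),
    (∀ o, x o ∈ convexHull ℝ (p.X o)) ∧ y ∈ p.Y ∧ c = p.lagrangian x y l}

/-- `l` is the unique maximizer of the dual function over `ℝ_+^J × ℝ^I`. -/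
def IsUniqueMultiplier (l : MultVec I J) : Prop :=
  DualFeasible l ∧ (∀ m, DualFeasible m → p.dual m ≤ p.dual l) ∧
    ∀ m, DualFeasible m → (∀ k, DualFeasible k → p.dual k ≤ p.dual m) → m = l

/-- Locally-non-polyhedral dual function: quadratic growth within distance `S` of `l`,
linear growth beyond. -/
def LocallyNonPolyhedral (l : MultVec I J) (S L L' : ℝ) : Prop :=
  0 < S ∧ 0 < L ∧ 0 < L' ∧
  (∀ m, DualFeasible m → ‖m - l‖ ≤ S → p.dual m + L * ‖m - l‖ ^ 2 ≤ p.dual l) ∧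
  (∀ m, DualFeasible m → S < ‖m - l‖ → p.dual m + L' * ‖m - l‖ ≤ p.dual l)

/-- A run of the drift-plus-penalty algorithm with parameter `V` and deterministic initial queues
`W0`, `Z0`. Ties between minimizers may be broken in any non-anticipating way. -/
structure IsRun [MeasurableSpace Ω] (V : ℝ) (W0 : EuclideanSpace ℝ (Fin J))
    (Z0 : EuclideanSpace ℝ (Fin I)) {Ω' : Type*} [MeasurableSpace Ω'] (P : Measure Ω')
    (st : ℕ → Ω' → Ω) (x y : ℕ → Ω' → EuclideanSpace ℝ (Fin I))
    (W : ℕ → Ω' → EuclideanSpace ℝ (Fin J)) (Z : ℕ → Ω' → EuclideanSpace ℝ (Fin I)) :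
    Prop where
  states : IsStateProcess p.prob P st (fun t a => (st t a, x t a, y t a))
  measurable_x : ∀ t, Measurable (x t)
  measurable_y : ∀ t, Measurable (y t)
  W0_nonneg : ∀ j, 0 ≤ W0 j
  W_zero : ∀ a, W 0 a = W0
  Z_zero : ∀ a, Z 0 a = Z0
  x_mem : ∀ t a, x t a ∈ p.X (st t a)
  x_min : ∀ t a, ∀ x' ∈ p.X (st t a), inner ℝ (Z t a) (x t a) ≤ inner ℝ (Z t a) x'
  y_mem : ∀ t a, y t a ∈ p.Y
  y_min : ∀ t a, ∀ y' ∈ p.Y,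
    V * p.f (y t a) + ∑ j, W t a j * p.g j (y t a) - inner ℝ (Z t a) (y t a)
      ≤ V * p.f y' + ∑ j, W t a j * p.g j y' - inner ℝ (Z t a) y'
  W_succ : ∀ t a j, W (t + 1) a j = max (W t a j + p.g j (y t a)) 0
  Z_succ : ∀ t a, Z (t + 1) a = Z t a + x t a - y t a

end TAProblem

/-- `B_G(V)`. -/
def bG (C L V : ℝ) : ℝ :=
  max (1 / √V) (√V * ((1 + √(1 + 4 * L * C)) / (2 * L)))

/-- `B_G'`. -/
def bG' (C L' : ℝ) : ℝ := max (L' / 2) (2 * C / L')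

/-- `r_G(V)`. -/
def rG (C V : ℝ) : ℝ := 3 / (6 * C * √V + √(2 * C))

/-- `ρ_G(V)`. -/
def rhoG (C V : ℝ) : ℝ := 1 - 3 / (12 * C * V + 2 * √(2 * C * V))

/-- `D_G(V)`. -/
def dG (C L V : ℝ) : ℝ :=
  Real.exp (rG C V * bG C L V) * (Real.exp (rG C V * √(2 * C)) - rhoG C V) / (1 - rhoG C V)

/-- `U_G(V)`. -/
def uG (C L V : ℝ) : ℝ := Real.log (dG C L V + Real.exp (rG C V * bG C L V)) / rG C V

/-- `U_G'(V)`. -/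
def uG' (C L V : ℝ) : ℝ := 2 * (dG C L V + Real.exp (rG C V * bG C L V)) / rG C V ^ 2

/-- Transient time: the first slot in which `Q(t) = (W(t), Z(t))` is at distance less than `B`
from `V λ*` (`⊤` if there is none). -/
def transientTime {I J : ℕ} {Ω' : Type*} (l : MultVec I J) (V B : ℝ)
    (W : ℕ → Ω' → EuclideanSpace ℝ (Fin J)) (Z : ℕ → Ω' → EuclideanSpace ℝ (Fin I))
    (a : Ω') : ℕ∞ :=
  sInf ((fun t : ℕ => (t : ℕ∞)) '' {t | ‖multVec (W t a) (Z t a) - V • l‖ < B})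

/-- `Φ` holds in the steady state from `t₀` on, i.e. for `t₀ ≥ τ` with `τ` the random transient
time: under the law of the process if `τ ≤ t₀` almost surely, and under the conditional law given
`τ = s` for every `s ≤ t₀` that has positive probability. -/
def InSteadyState {Ω' : Type*} [MeasurableSpace Ω'] (P : Measure Ω') (τ : Ω' → ℕ∞) (t₀ : ℕ)
    (Φ : Measure Ω' → Prop) : Prop :=
  ((∀ᵐ a ∂P, τ a ≤ (t₀ : ℕ∞)) → Φ P) ∧
    ∀ s : ℕ, s ≤ t₀ → P {a | τ a = (s : ℕ∞)} ≠ 0 → Φ (P[|{a | τ a = (s : ℕ∞)}])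

/-- For every run of the algorithm with parameter `V` (any probability space, initial queues and
tie-breaking), every `t₀ ≥ T_G` and every `T ≥ 1`, the numbers `f(x̄(t₀,T))`, `g_j(x̄(t₀,T))` are
integrable and `Φ T (E[f(x̄(t₀,T))] - fopt) (fun j => E[g_j(x̄(t₀,T))])` holds. -/
def SteadyAverages {Ω : Type u} [MeasurableSpace Ω] {I J : ℕ} (p : TAProblem Ω I J)
    (l : MultVec I J) (L V : ℝ) (Φ : ℕ → ℝ → (Fin J → ℝ) → Prop) : Prop :=
  ∀ (Ω' : Type v) [MeasurableSpace Ω'] (P : Measure Ω') [IsProbabilityMeasure P]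
    (W0 : EuclideanSpace ℝ (Fin J)) (Z0 : EuclideanSpace ℝ (Fin I))
    (st : ℕ → Ω' → Ω) (x y : ℕ → Ω' → EuclideanSpace ℝ (Fin I))
    (W : ℕ → Ω' → EuclideanSpace ℝ (Fin J)) (Z : ℕ → Ω' → EuclideanSpace ℝ (Fin I)),
    p.IsRun V W0 Z0 P st x y W Z →
    ∀ t₀ T : ℕ, 0 < T →
      InSteadyState P (transientTime l V (bG p.driftConst L V) W Z) t₀ (fun ν =>
        Integrable (fun a => p.f (slotAvg x t₀ T a)) ν ∧
        (∀ j, Integrable (fun a => p.g j (slotAvg x t₀ T a)) ν) ∧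
        Φ T ((∫ a, p.f (slotAvg x t₀ T a) ∂ν) - p.fopt)
          (fun j => ∫ a, p.g j (slotAvg x t₀ T a) ∂ν))

/-- The objective bound and the constraint bounds of the `T`-slot averages, in terms of bounds
`U`, `U'` on the first and second moments of the distance of the queues to `V λ*`. -/
def FormBound {J : ℕ} (Mf : ℝ) (Mg : Fin J → ℝ) (C normL V U U' : ℝ)
    (T : ℕ) (gap : ℝ) (viol : Fin J → ℝ) : Prop :=
  gap ≤ 2 * Mf * U / T + (U' + 4 * V * U * normL) / (2 * T * V) + C / V ∧
    ∀ j, viol j ≤ 2 * U / T + 2 * Mg j * U / T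

end

/-! Put k(t) = ‖Q(t) − Vλ*‖. The algorithm is a stochastic subgradient ascent on the dual function,
run on the scaled queues Q(t)/V: the two minimizations of a slot minimize the Lagrangian at Q(t)/V,
and the queue update is a step along (g(y), x − y) followed by the projection onto w ≥ 0. Pathwise
(`IsRun.sq_drift_le`), k(t+1)² ≤ k(t)² + 2C + 2V(d(Q(t)/V) − d(λ*)) + 2N(t). The noise N(t) collects
the deviations of min over X_ω of zᵀx from its mean over ω, at z = Z(t)/V and at the z-part of λ*.
The state is independent of the past, so N(t) times a bounded function of the past has mean zero;
this replaces conditional expectations throughout.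

The growth of d (`dual_gap_ge`) turns 2C + 2V(d(Q/V) − d(λ*)) into at most −2k/√V once k ≥ B_G(V).
So outside this ball k drifts inwards at rate 1/√V, with increments at most √(2C). An exponential
Lyapunov function of k then contracts in mean outside the ball and grows by a bounded amount inside,
hence its mean stays bounded from the hitting time on (`IsRun.integral_lyapunov_le`). This bounds
the first two moments of k (`moments_le_of_exp`).

The function exp(rk) gives U_G. Its growth in the ball is of order 1/√V against a contraction of
order 1/V, so D is of order √V and U_G of order √V log V. The function exp(η√(k² + V)/√V) removes
the logarithm: √(k² + V) is smooth at k = 0, the first-order noise averages out inside the ball too,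
and the growth there is also of order 1/V.

For the averages, Jensen's inequality for y(t), telescoping of Z, W and ‖Q‖², and weak duality
d(Q/V) ≤ f^(opt) (`Standing.dual_le_fopt`) leave only terms at the two ends of the window,
controlled by k(t₀) and k(t₀+T); the Lipschitz bounds pass from the average of y to that of x. Since
the event T_G = s is determined before the state of slot s is drawn, conditioning on it keeps the
later states fresh. -/

/-! ### Bounds on the exponential function. -/

/-- Bernstein's bound on the exponential function. -/
theorem Real.exp_le_bernstein {x c : ℝ} (hx : |x| ≤ c) (hc : c < 3) :
    Real.exp x ≤ 1 + x + c ^ 2 / (2 * (1 - c / 3)) := by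
  have hc0 : 0 ≤ c := (abs_nonneg x).trans hx
  have h1 : HasSum (fun n : ℕ => x ^ n / (n.factorial : ℝ)) (Real.exp x) := by
    rw [Real.exp_eq_exp_ℝ]; exact NormedSpace.expSeries_div_hasSum_exp x
  have h2 : HasSum (fun n : ℕ => x ^ (n + 2) / ((n + 2).factorial : ℝ))
      (Real.exp x - (1 + x)) := by
    have := (hasSum_nat_add_iff' 2).2 h1
    simpa [Finset.sum_range_succ] using this
  have h3 : HasSum (fun n : ℕ => c ^ 2 / 2 * (c / 3) ^ n) (c ^ 2 / 2 * (1 - c / 3)⁻¹) :=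
    (hasSum_geometric_of_lt_one (by positivity) (by linarith)).mul_left _
  -- This compares the tail of the exponential series with a geometric series of ratio c/3.
  have hf : ∀ n : ℕ, (2 * 3 ^ n : ℝ) ≤ ((n + 2).factorial : ℝ) := by
    intro n
    induction n with
    | zero => simp
    | succ k ih =>
      rw [show k + 1 + 2 = (k + 2) + 1 by ring, Nat.factorial_succ]
      push_cast
      have : (0 : ℝ) ≤ k := Nat.cast_nonneg k
      rw [pow_succ]
      nlinarith [pow_pos (show (0 : ℝ) < 3 by norm_num) k]
  have h4 := hasSum_le (fun n => ?_) h2 h3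
  · have : c ^ 2 / (2 * (1 - c / 3)) = c ^ 2 / 2 * (1 - c / 3)⁻¹ := by
      rw [← div_div, div_eq_mul_inv]
    linarith
  · have h5 : x ^ (n + 2) ≤ c ^ (n + 2) :=
      (le_abs_self _).trans (by rw [abs_pow]; exact pow_le_pow_left₀ (abs_nonneg x) hx _)
    calc x ^ (n + 2) / ((n + 2).factorial : ℝ) ≤ c ^ (n + 2) / ((n + 2).factorial : ℝ) := by
          gcongr
      _ ≤ c ^ (n + 2) / (2 * 3 ^ n) := by
          gcongr; exact hf n
      _ = c ^ 2 / 2 * (c / 3) ^ n := by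
          rw [div_pow, pow_add]; field_simp

/-- `e^x ≤ 1 + x + c²` if `|x| ≤ c ≤ 1`. -/
theorem Real.exp_le_one_add_add_sq {x c : ℝ} (hx : |x| ≤ c) (hc : c ≤ 1) :
    Real.exp x ≤ 1 + x + c ^ 2 := by
  have h1 := (abs_le.1 (Real.abs_exp_sub_one_sub_id_le (hx.trans hc))).2
  have h2 : x ^ 2 ≤ c ^ 2 := sq_le_sq' (by linarith [abs_le.1 hx]) (by linarith [abs_le.1 hx])
  linarith

noncomputable section

/-! ### Minima of linear functions over a set. -/

section MinInner

variable {E : Type*} [NormedAddCommGroup E] [InnerProductSpace ℝ E]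

/-- The minimum of the linear function `⟪z, ·⟫` over `X`. -/
def minInner (X : Set E) (z : E) : ℝ := sInf ((fun x => inner ℝ z x) '' X)

variable {X : Set E} {R : ℝ}

theorem minInner_le (hR : ∀ x ∈ X, ‖x‖ ≤ R) (z : E) {x : E} (hx : x ∈ X) :
    minInner X z ≤ inner ℝ z x := by
  refine csInf_le ⟨-(‖z‖ * R), ?_⟩ ⟨x, hx, rfl⟩
  rintro _ ⟨y, hy, rfl⟩
  have h := abs_le.1 (abs_real_inner_le_norm z y)
  have := mul_le_mul_of_nonneg_left (hR y hy) (norm_nonneg z)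
  show -(‖z‖ * R) ≤ inner ℝ z y
  linarith [h.1]

theorem le_minInner (hne : X.Nonempty) {z : E} {q : ℝ} (h : ∀ x ∈ X, q ≤ inner ℝ z x) :
    q ≤ minInner X z := by
  refine le_csInf (hne.image _) ?_
  rintro _ ⟨y, hy, rfl⟩
  exact h y hy

theorem minInner_le_of_mem_convexHull (hR : ∀ x ∈ X, ‖x‖ ≤ R) (z : E) {x : E}
    (hx : x ∈ convexHull ℝ X) : minInner X z ≤ inner ℝ z x := by
  have hc : Convex ℝ {x : E | minInner X z ≤ inner ℝ z x} :=
    convex_halfSpace_ge (innerₛₗ ℝ z).isLinear _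
  exact convexHull_min (fun y hy => minInner_le hR z hy) hc hx

theorem exists_eq_minInner (hX : IsCompact X) (hne : X.Nonempty) (z : E) :
    ∃ x ∈ X, minInner X z = inner ℝ z x := by
  obtain ⟨x, hx, h⟩ := hX.exists_sInf_image_eq hne (f := fun x => inner ℝ z x) (by fun_prop)
  exact ⟨x, hx, h⟩

theorem abs_minInner_le (hR : ∀ x ∈ X, ‖x‖ ≤ R) (hne : X.Nonempty) (z : E) :
    |minInner X z| ≤ ‖z‖ * R := by
  have h : ∀ x ∈ X, |inner ℝ z x| ≤ ‖z‖ * R := fun x hx =>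
    (abs_real_inner_le_norm z x).trans (mul_le_mul_of_nonneg_left (hR x hx) (norm_nonneg z))
  obtain ⟨x, hx⟩ := hne
  refine abs_le.2 ⟨le_minInner ⟨x, hx⟩ fun y hy => (abs_le.1 (h y hy)).1, ?_⟩
  exact (minInner_le hR z hx).trans (abs_le.1 (h x hx)).2

/-- An infimum of R-Lipschitz functions is R-Lipschitz. -/
theorem continuous_minInner (hR : ∀ x ∈ X, ‖x‖ ≤ R) (hR0 : 0 ≤ R) (hne : X.Nonempty) :
    Continuous (minInner X) := by
  refine (LipschitzWith.of_le_add_mul ⟨R, hR0⟩ fun z z' => ?_).continuous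
  rw [← sub_le_iff_le_add]
  refine le_minInner hne fun x hx => ?_
  have h1 := minInner_le hR z hx
  have h2 : inner ℝ z x - inner ℝ z' x ≤ R * dist z z' := by
    rw [← inner_sub_left, dist_eq_norm, mul_comm]
    exact (real_inner_le_norm _ _).trans (mul_le_mul_of_nonneg_left (hR x hx) (norm_nonneg _))
  change _ - R * dist z z' ≤ _
  linarith

/-- Positive homogeneity: a decision chosen for the queue Z also minimizes at the dual point Z/V. -/
theorem minInner_smul_eq (hR : ∀ x ∈ X, ‖x‖ ≤ R) {z x : E} (hx : x ∈ X)
    (h : ∀ x' ∈ X, inner ℝ z x ≤ inner ℝ z x') {c : ℝ} (hc : 0 ≤ c) :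
    minInner X (c • z) = c * inner ℝ z x := by
  refine le_antisymm ((minInner_le hR _ hx).trans_eq (real_inner_smul_left _ _ _)) ?_
  refine le_minInner ⟨x, hx⟩ fun y hy => ?_
  rw [real_inner_smul_left]
  exact mul_le_mul_of_nonneg_left (h y hy) hc

end MinInner

theorem LipschitzOnWith.of_abs_sub_le {E : Type*} [SeminormedAddCommGroup E] {f : E → ℝ}
    {s : Set E} {M : ℝ} (hM : 0 ≤ M) (h : ∀ x ∈ s, ∀ y ∈ s, |f x - f y| ≤ M * ‖x - y‖) :
    LipschitzOnWith ⟨M, hM⟩ f s :=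
  LipschitzOnWith.of_dist_le_mul fun x hx y hy => by
    rw [Real.dist_eq, dist_eq_norm]; exact h x hx y hy

/-! ### Consequences of the standing assumptions. -/

namespace TAProblem

variable {Ω : Type u} {I J : ℕ} {p : TAProblem Ω I J} {Mf : ℝ} {Mg : Fin J → ℝ}

namespace Standing

variable (hp : p.Standing Mf Mg)
include hp

theorem Xbar_nonempty : p.Xbar.Nonempty := by
  obtain ⟨x, hx, -⟩ := hp.slater
  exact ⟨x, interior_subset hx⟩

theorem X_nonempty (o : Ω) : (p.X o).Nonempty := by
  obtain ⟨-, x, hx, -⟩ := hp.Xbar_nonempty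
  exact convexHull_nonempty_iff.1 ⟨_, hx o⟩

theorem Y_nonempty : p.Y.Nonempty := hp.Xbar_nonempty.mono hp.Xbar_subset

theorem X_compact (o : Ω) : IsCompact (p.X o) :=
  Metric.isCompact_of_isClosed_isBounded (hp.X_closed o) (hp.X_bounded o)

theorem exists_radius : ∃ R, 0 ≤ R ∧ (∀ x ∈ p.box, ‖x‖ ≤ R) ∧ ∀ x ∈ p.Y, ‖x‖ ≤ R := by
  obtain ⟨R, h0, h⟩ := (hp.box_bounded.union hp.Y_bounded).exists_pos_norm_le
  exact ⟨R, h0.le, fun x hx => h x (Or.inl hx), fun x hx => h x (Or.inr hx)⟩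

theorem exists_X_radius : ∃ R, 0 ≤ R ∧ ∀ o, ∀ x ∈ p.X o, ‖x‖ ≤ R := by
  obtain ⟨R, hR0, hR, -⟩ := hp.exists_radius
  exact ⟨R, hR0, fun o x hx => hR x (hp.X_subset o hx)⟩

/-- Nothing is known about `p.f` off this set, not even measurability. A Lipschitz extension to the
whole space supplies measurability and bounds for its values along the process. -/
theorem exists_extension_f : ∃ F : EuclideanSpace ℝ (Fin I) → ℝ, Continuous F ∧
    Set.EqOn p.f F (p.Y ∪ convexHull ℝ (⋃ o, p.X o)) := by
  obtain ⟨F, hF, h⟩ := (LipschitzOnWith.of_abs_sub_le hp.Mf_pos.le hp.f_lip).extend_real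
  exact ⟨F, hF.continuous, h⟩

theorem exists_extension_g (j : Fin J) : ∃ F : EuclideanSpace ℝ (Fin I) → ℝ, Continuous F ∧
    Set.EqOn (p.g j) F (p.Y ∪ convexHull ℝ (⋃ o, p.X o)) := by
  obtain ⟨F, hF, h⟩ :=
    (LipschitzOnWith.of_abs_sub_le (hp.Mg_pos j).le (hp.g_lip j)).extend_real
  exact ⟨F, hF.continuous, h⟩

theorem isBounded_values : Bornology.IsBounded (p.Y ∪ convexHull ℝ (⋃ o, p.X o)) := by
  refine hp.Y_bounded.union ?_
  rw [isBounded_convexHull]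
  exact hp.box_bounded.subset (Set.iUnion_subset hp.X_subset)

theorem exists_bound_of_extension {φ F : EuclideanSpace ℝ (Fin I) → ℝ} (hF : Continuous F)
    (h : Set.EqOn φ F (p.Y ∪ convexHull ℝ (⋃ o, p.X o))) :
    ∃ b, ∀ x ∈ p.Y ∪ convexHull ℝ (⋃ o, p.X o), |φ x| ≤ b := by
  obtain ⟨b, hb⟩ :=
    hp.isBounded_values.isCompact_closure.exists_bound_of_continuousOn hF.continuousOn
  exact ⟨b, fun x hx => by rw [h hx]; exact hb x (subset_closure hx)⟩

theorem exists_bound_f : ∃ b, ∀ x ∈ p.Y ∪ convexHull ℝ (⋃ o, p.X o), |p.f x| ≤ b := by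
  obtain ⟨F, hF, h⟩ := hp.exists_extension_f
  exact hp.exists_bound_of_extension hF h

theorem exists_bound_g (j : Fin J) :
    ∃ b, ∀ x ∈ p.Y ∪ convexHull ℝ (⋃ o, p.X o), |p.g j x| ≤ b := by
  obtain ⟨F, hF, h⟩ := hp.exists_extension_g j
  exact hp.exists_bound_of_extension hF h

theorem drift_le {x y : EuclideanSpace ℝ (Fin I)} (hx : x ∈ p.box) (hy : y ∈ p.Y) :
    ∑ j, p.g j y ^ 2 + ‖x - y‖ ^ 2 ≤ 2 * p.driftConst := by
  have h : (∑ j, p.g j y ^ 2 + ‖x - y‖ ^ 2) / 2 ≤ p.driftConst := by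
    refine le_csSup ?_ ⟨x, hx, y, hy, rfl⟩
    obtain ⟨R, hR0, hR1, hR2⟩ := hp.exists_radius
    choose b hb using hp.exists_bound_g
    refine ⟨(∑ j, b j ^ 2 + (2 * R) ^ 2) / 2, ?_⟩
    rintro _ ⟨x, hx, y, hy, rfl⟩
    have h1 : ∑ j, p.g j y ^ 2 ≤ ∑ j, b j ^ 2 := Finset.sum_le_sum fun j _ => by
      have := abs_le.1 (hb j y (Or.inl hy))
      exact sq_le_sq' this.1 this.2
    have h2 : ‖x - y‖ ≤ 2 * R := by
      have := norm_sub_le x y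
      linarith [hR1 x hx, hR2 y hy]
    have h3 := pow_le_pow_left₀ (norm_nonneg _) h2 2
    linarith
  linarith

/-- The Slater point lies in `p.Y` and has a nonzero constraint value, since there is at least one
constraint. -/
theorem driftConst_pos (hJ : 0 < J) : 0 < p.driftConst := by
  obtain ⟨x, hx, hg⟩ := hp.slater
  obtain ⟨o, -⟩ := p.prob.support_nonempty
  obtain ⟨x', hx'⟩ := hp.X_nonempty o
  have h1 := hp.drift_le (hp.X_subset o hx') (hp.Xbar_subset (interior_subset hx))
  have h2 : 0 < p.g ⟨0, hJ⟩ x ^ 2 := by exact sq_pos_of_neg (hg ⟨0, hJ⟩)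
  have h3 := Finset.single_le_sum (f := fun j => p.g j x ^ 2)
    (fun j _ => sq_nonneg _) (Finset.mem_univ (⟨0, hJ⟩ : Fin J))
  have h4 := sq_nonneg ‖x' - x‖
  linarith

end Standing

/-! ### The dual function as a minimum over y plus a mean of minima over x. -/

variable [MeasurableSpace Ω] [Countable Ω] [MeasurableSingletonClass Ω]

variable (p) in
/-- `∑_ω π_ω min_{x ∈ X_ω} ⟪z, x⟫`. -/
def meanMin (z : EuclideanSpace ℝ (Fin I)) : ℝ :=
  ∫ o, minInner (p.X o) z ∂p.prob.toMeasure

namespace Standing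

variable (hp : p.Standing Mf Mg)
include hp

theorem integrable_minInner (z : EuclideanSpace ℝ (Fin I)) :
    Integrable (fun o => minInner (p.X o) z) p.prob.toMeasure := by
  obtain ⟨R, hR0, hR⟩ := hp.exists_X_radius
  exact Integrable.of_bound Measurable.of_discrete.aestronglyMeasurable (‖z‖ * R)
    (ae_of_all _ fun o => abs_minInner_le (hR o) (hp.X_nonempty o) z)

theorem integrable_selection {x : Ω → EuclideanSpace ℝ (Fin I)}
    (hx : ∀ o, x o ∈ convexHull ℝ (p.X o)) : Integrable x p.prob.toMeasure := by
  obtain ⟨R, hR0, hR, -⟩ := hp.exists_radius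
  refine Integrable.of_bound Measurable.of_discrete.aestronglyMeasurable R
    (ae_of_all _ fun o => ?_)
  have : convexHull ℝ (p.X o) ⊆ Metric.closedBall 0 R :=
    convexHull_min (fun y hy => by simpa using hR y (hp.X_subset o hy)) (convex_closedBall 0 R)
  simpa using this (hx o)

theorem lagrangian_eq {x : Ω → EuclideanSpace ℝ (Fin I)}
    (hx : ∀ o, x o ∈ convexHull ℝ (p.X o)) (y : EuclideanSpace ℝ (Fin I)) (l : MultVec I J) :
    p.lagrangian x y l = p.f y + ∑ j, l.fst j * p.g j y - inner ℝ l.snd y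
      + ∫ o, inner ℝ l.snd (x o) ∂p.prob.toMeasure := by
  have hi : Integrable (fun o => inner ℝ l.snd (x o)) p.prob.toMeasure :=
    (hp.integrable_selection hx).const_inner _
  have hi' : Integrable (fun o => p.f y + ∑ j, l.fst j * p.g j y - inner ℝ l.snd y
      + inner ℝ l.snd (x o)) p.prob.toMeasure := (integrable_const _).add hi
  have h := PMF.integral_eq_tsum p.prob _ hi'
  rw [integral_add (integrable_const _) hi] at h
  simp only [integral_const, probReal_univ, smul_eq_mul, one_mul] at h
  rw [h]
  unfold lagrangian wt
  refine tsum_congr fun o => ?_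
  rw [inner_sub_right]
  ring

/-- Needed because the real infimum of a set unbounded below is the default value 0. -/
theorem bddBelow_lagrangian (l : MultVec I J) :
    BddBelow {c | ∃ (x : Ω → EuclideanSpace ℝ (Fin I)) (y : EuclideanSpace ℝ (Fin I)),
      (∀ o, x o ∈ convexHull ℝ (p.X o)) ∧ y ∈ p.Y ∧ c = p.lagrangian x y l} := by
  obtain ⟨R, hR0, hR1, hR2⟩ := hp.exists_radius
  obtain ⟨bf, hbf⟩ := hp.exists_bound_f
  choose b hb using hp.exists_bound_g
  refine ⟨-bf + ∑ j, -(|l.fst j| * b j) - ‖l.snd‖ * R + p.meanMin l.snd, ?_⟩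
  rintro _ ⟨x, y, hx, hy, rfl⟩
  rw [hp.lagrangian_eq hx]
  have h1 := (abs_le.1 (hbf y (Or.inl hy))).1
  have h2 : ∑ j, -(|l.fst j| * b j) ≤ ∑ j, l.fst j * p.g j y := Finset.sum_le_sum fun j _ => by
    have h : |l.fst j * p.g j y| ≤ |l.fst j| * b j := by
      rw [abs_mul]; exact mul_le_mul_of_nonneg_left (hb j y (Or.inl hy)) (abs_nonneg _)
    exact (abs_le.1 h).1
  have h3 : inner ℝ l.snd y ≤ ‖l.snd‖ * R :=
    (real_inner_le_norm _ _).trans (mul_le_mul_of_nonneg_left (hR2 y hy) (norm_nonneg _))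
  have h4 : p.meanMin l.snd ≤ ∫ o, inner ℝ l.snd (x o) ∂p.prob.toMeasure :=
    integral_mono (hp.integrable_minInner _) ((hp.integrable_selection hx).const_inner _)
      fun o => minInner_le_of_mem_convexHull (fun x hx => hR1 x (hp.X_subset o hx)) _ (hx o)
  linarith

/-- The infimum over x separates over the states, and a linear function attains its minimum over
conv X_ω in X_ω itself, so a minimizing selection is a feasible point. -/
theorem dual_le (l : MultVec I J) {y : EuclideanSpace ℝ (Fin I)} (hy : y ∈ p.Y) :
    p.dual l ≤ p.f y + ∑ j, l.fst j * p.g j y - inner ℝ l.snd y + p.meanMin l.snd := by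
  choose x hx hmin using fun o => exists_eq_minInner (hp.X_compact o) (hp.X_nonempty o) l.snd
  have hx' : ∀ o, x o ∈ convexHull ℝ (p.X o) := fun o => subset_convexHull ℝ _ (hx o)
  refine csInf_le (hp.bddBelow_lagrangian l) ⟨x, y, hx', hy, ?_⟩
  rw [hp.lagrangian_eq hx', meanMin]
  simp only [hmin]

theorem le_dual (l : MultVec I J) {q : ℝ}
    (hq : ∀ y ∈ p.Y, q ≤ p.f y + ∑ j, l.fst j * p.g j y - inner ℝ l.snd y) :
    q + p.meanMin l.snd ≤ p.dual l := by
  obtain ⟨R, hR0, hR⟩ := hp.exists_X_radius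
  obtain ⟨y, hy⟩ := hp.Y_nonempty
  choose x hx using hp.X_nonempty
  refine le_csInf ⟨_, x, y, fun o => subset_convexHull ℝ _ (hx o), hy, rfl⟩ ?_
  rintro _ ⟨x, y, hx, hy, rfl⟩
  rw [hp.lagrangian_eq hx]
  have h4 : p.meanMin l.snd ≤ ∫ o, inner ℝ l.snd (x o) ∂p.prob.toMeasure :=
    integral_mono (hp.integrable_minInner _) ((hp.integrable_selection hx).const_inner _)
      fun o => minInner_le_of_mem_convexHull (hR o) _ (hx o)
  linarith [hq y hy]

end Standing

end TAProblem

/-! ### Admissible policies and weak duality. -/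

namespace TAProblem

variable {Ω : Type u} {I J : ℕ} {p : TAProblem Ω I J} {Mf : ℝ} {Mg : Fin J → ℝ}
variable [MeasurableSpace Ω] [Countable Ω] [MeasurableSingletonClass Ω]

theorem Standing.meanMin_le_of_mem_Xbar (hp : p.Standing Mf Mg)
    (z : EuclideanSpace ℝ (Fin I)) {m : EuclideanSpace ℝ (Fin I)} (hm : m ∈ p.Xbar) :
    p.meanMin z ≤ inner ℝ z m := by
  obtain ⟨x, hx, rfl⟩ := hm
  obtain ⟨R, hR0, hR⟩ := hp.exists_X_radius
  have hi := hp.integrable_selection hx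
  have h : ∑' o, p.wt o • x o = ∫ o, x o ∂p.prob.toMeasure :=
    (PMF.integral_eq_tsum p.prob x hi).symm
  rw [h, ← integral_inner hi]
  exact integral_mono (hp.integrable_minInner _) (hi.const_inner _)
    fun o => minInner_le_of_mem_convexHull (hR o) _ (hx o)

theorem Standing.meanMin_le_of_mem_closure_Xbar (hp : p.Standing Mf Mg)
    (z : EuclideanSpace ℝ (Fin I)) {m : EuclideanSpace ℝ (Fin I)} (hm : m ∈ closure p.Xbar) :
    p.meanMin z ≤ inner ℝ z m :=
  closure_minimal (t := {m | p.meanMin z ≤ inner ℝ z m})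
    (fun _ h => hp.meanMin_le_of_mem_Xbar z h)
    (isClosed_le continuous_const (by fun_prop)) hm

section Policy

variable {Ω' : Type*} [MeasurableSpace Ω'] {P : Measure Ω'} [IsProbabilityMeasure P]
  {st : ℕ → Ω' → Ω} {x : ℕ → Ω' → EuclideanSpace ℝ (Fin I)}

omit [Countable Ω] [MeasurableSingletonClass Ω] in
theorem IsPolicy.integrable (hp : p.Standing Mf Mg) (h : p.IsPolicy P st x) (t : ℕ) :
    Integrable (x t) P := by
  obtain ⟨R, hR0, hR⟩ := hp.exists_X_radius
  exact Integrable.of_bound (h.measurable t).aestronglyMeasurable R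
    (ae_of_all _ fun a => hR _ _ (h.mem t a))

/-- Conditionally on the state o, the mean decision is an average of points of X_o, and the total
mean is the mixture of these conditional means. The closure costs nothing: the result is used only
for linear inequalities and for membership in the closed set `p.Y`. -/
theorem IsPolicy.integral_mem_closure_Xbar (hp : p.Standing Mf Mg) (h : p.IsPolicy P st x)
    (t : ℕ) : ∫ a, x t a ∂P ∈ closure p.Xbar := by
  classical
  have hm : ∀ o, MeasurableSet (st t ⁻¹' {o}) := fun o =>
    h.states.measurable t (measurableSet_singleton o)
  have hwt : ∀ o, p.wt o = P.real (st t ⁻¹' {o}) := fun o => by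
    rw [wt, ← PMF.toMeasure_apply_singleton p.prob o (measurableSet_singleton o),
      ← h.states.law t, Measure.map_apply (h.states.measurable t) (measurableSet_singleton o)]
    rfl
  choose x₀ hx₀ using hp.X_nonempty
  -- On a null state the set average is the default value 0, which need not lie in the hull; any
  -- point of X_o serves instead.
  let m : Ω → EuclideanSpace ℝ (Fin I) :=
    fun o => if P (st t ⁻¹' {o}) = 0 then x₀ o else ⨍ a in st t ⁻¹' {o}, x t a ∂P
  have hmc : ∀ o, m o ∈ closure (convexHull ℝ (p.X o)) := fun o => by
    dsimp only [m]
    split_ifs with h0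
    · exact subset_closure (subset_convexHull ℝ _ (hx₀ o))
    · refine (convex_convexHull ℝ _).closure.set_average_mem isClosed_closure h0
        (measure_ne_top _ _) ?_ (h.integrable hp t).integrableOn
      refine (ae_restrict_iff' (hm o)).2 (ae_of_all _ fun a ha => ?_)
      have : st t a = o := ha
      exact subset_closure (subset_convexHull ℝ _ (this ▸ h.mem t a))
  have hsum : ∫ a, x t a ∂P = ∑' o, p.wt o • m o := by
    have hU : (⋃ o, st t ⁻¹' {o}) = Set.univ := by
      ext a; simp
    have h1 := integral_iUnion hm (fun o o' hne => ?_)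
      (h.integrable hp t).integrableOn (μ := P)
    · rw [hU, Measure.restrict_univ] at h1
      rw [h1]
      refine tsum_congr fun o => ?_
      rw [hwt]
      dsimp only [m]
      split_ifs with h0
      · rw [Measure.restrict_eq_zero.2 h0]; simp [Measure.real, h0]
      · exact (measure_smul_setAverage _ (measure_ne_top _ _)).symm
    · exact Set.disjoint_left.2 fun a ha ha' => hne (ha.symm.trans ha')
  -- Replacing every conditional mean by a point of the hull within ε/2, uniformly in the state,
  -- moves the mixture by at most ε/2.
  refine Metric.mem_closure_iff.2 fun ε hε => ?_
  choose x' hx' hd using fun o => Metric.mem_closure_iff.1 (hmc o) (ε / 2) (half_pos hε)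
  refine ⟨_, ⟨x', hx', rfl⟩, ?_⟩
  have hi' := hp.integrable_selection hx'
  have hi : Integrable m p.prob.toMeasure := by
    have : Integrable (fun o => m o - x' o) p.prob.toMeasure :=
      Integrable.of_bound Measurable.of_discrete.aestronglyMeasurable (ε / 2)
        (ae_of_all _ fun o => by rw [← dist_eq_norm]; exact (hd o).le)
    exact (this.add hi').congr (ae_of_all _ fun o => by simp)
  have e1 := PMF.integral_eq_tsum p.prob m hi
  have e2 := PMF.integral_eq_tsum p.prob x' hi'
  unfold wt at hsum ⊢
  rw [hsum, ← e1, ← e2, dist_eq_norm, ← integral_sub hi hi']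
  refine lt_of_le_of_lt (norm_integral_le_of_norm_le_const (C := ε / 2)
    (ae_of_all _ fun o => by rw [← dist_eq_norm]; exact (hd o).le)) ?_
  simp [hε]

theorem IsPolicy.meanAvg_mem (hp : p.Standing Mf Mg) (h : p.IsPolicy P st x) {T : ℕ}
    (hT : 0 < T) : meanAvg P x T ∈ p.Y := by
  rw [meanAvg, Finset.smul_sum]
  refine hp.Y_convex.sum_mem (fun _ _ => by positivity) ?_
    fun t _ => closure_minimal hp.Xbar_subset hp.Y_closed (h.integral_mem_closure_Xbar hp t)
  have : (T : ℝ) ≠ 0 := by positivity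
  simp [this]

/-- The mean average can be taken as y. The z-terms then contribute at most 0, because the same
point is a limit of averages of hull selections. -/
theorem IsPolicy.dual_le (hp : p.Standing Mf Mg) (h : p.IsPolicy P st x) (l : MultVec I J)
    {T : ℕ} (hT : 0 < T) :
    p.dual l ≤ p.f (meanAvg P x T) + ∑ j, l.fst j * p.g j (meanAvg P x T) := by
  have h1 := hp.dual_le l (h.meanAvg_mem hp hT)
  have h2 : p.meanMin l.snd ≤ inner ℝ l.snd (meanAvg P x T) := by
    have hT' : (0 : ℝ) < T := by positivity
    rw [meanAvg, inner_smul_right, inner_sum, inv_mul_eq_div, le_div_iff₀ hT', mul_comm]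
    calc (T : ℝ) * p.meanMin l.snd = ∑ _t ∈ Finset.range T, p.meanMin l.snd := by simp
      _ ≤ _ := Finset.sum_le_sum fun t _ =>
        hp.meanMin_le_of_mem_closure_Xbar _ (h.integral_mem_closure_Xbar hp t)
  linarith

theorem IsPolicy.dual_le_limsup (hp : p.Standing Mf Mg) (h : p.IsPolicy P st x)
    {l : MultVec I J} (hl : DualFeasible l)
    (hg : ∀ j, limsup (fun T => p.g j (meanAvg P x T)) atTop ≤ 0) :
    p.dual l ≤ limsup (fun T => p.f (meanAvg P x T)) atTop := by
  have hbdd : ∀ φ : EuclideanSpace ℝ (Fin I) → ℝ,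
      (∃ b, ∀ x ∈ p.Y ∪ convexHull ℝ (⋃ o, p.X o), |φ x| ≤ b) →
      IsBoundedUnder (· ≤ ·) atTop (fun T => φ (meanAvg P x T)) := by
    rintro φ ⟨b, hb⟩
    refine ⟨b, eventually_map.2 ?_⟩
    filter_upwards [eventually_gt_atTop 0] with T hT
    exact (abs_le.1 (hb _ (Or.inl (h.meanAvg_mem hp hT)))).2
  have hs : 0 ≤ ∑ j, l.fst j := Finset.sum_nonneg fun j _ => hl j
  refine le_of_forall_pos_le_add fun ε hε => ?_
  -- Constraint violations of this size, weighted by the multipliers, total at most ε; the 1 avoids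
  -- a division by zero.
  have hδ : 0 < ε / (1 + ∑ j, l.fst j) := by positivity
  have hev : ∀ᶠ T in atTop, ∀ j, p.g j (meanAvg P x T) < ε / (1 + ∑ j, l.fst j) :=
    eventually_all.2 fun j => eventually_lt_of_limsup_lt ((hg j).trans_lt hδ)
      (hbdd _ (hp.exists_bound_g j))
  rw [← sub_le_iff_le_add]
  refine le_limsup_of_frequently_le (Eventually.frequently ?_) (hbdd _ hp.exists_bound_f)
  filter_upwards [hev, eventually_gt_atTop 0] with T hT hT0
  have h1 := h.dual_le hp l hT0
  have h2 : ∑ j, l.fst j * p.g j (meanAvg P x T)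
      ≤ ∑ j, l.fst j * (ε / (1 + ∑ j, l.fst j)) :=
    Finset.sum_le_sum fun j _ => mul_le_mul_of_nonneg_left (hT j).le (hl j)
  have h3 : ∑ j, l.fst j * (ε / (1 + ∑ j, l.fst j)) ≤ ε := by
    rw [← Finset.sum_mul, mul_div_assoc', div_le_iff₀ (by positivity)]
    nlinarith
  linarith

end Policy

/-- Pairs of a state and a decision that is allowed in it. -/
abbrev Admissible (p : TAProblem Ω I J) : Type u :=
  {q : Ω × EuclideanSpace ℝ (Fin I) // q.2 ∈ p.X q.1}

omit [Countable Ω] [MeasurableSingletonClass Ω] in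
theorem measurable_decision (p : TAProblem Ω I J) :
    Measurable fun q : Admissible p => q.1.2 := by fun_prop

omit [Countable Ω] [MeasurableSingletonClass Ω] in
/-- A point of `conv X_o` is the mean of a random decision in state `o`. -/
theorem exists_decision_law {o : Ω} {v : EuclideanSpace ℝ (Fin I)}
    (hv : v ∈ convexHull ℝ (p.X o)) :
    ∃ μ : Measure (Admissible p), IsProbabilityMeasure μ ∧
      (∀ φ : Ω → ENNReal, Measurable φ → ∫⁻ q, φ q.1.1 ∂μ = φ o) ∧ ∫ q, q.1.2 ∂μ = v := by
  rw [convexHull_eq] at hv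
  obtain ⟨ι, s, w, z, hw, hw1, hz, rfl⟩ := hv
  let _ : MeasurableSpace s := ⊤
  let q : PMF s := PMF.ofFintype (fun i => ENNReal.ofReal (w i)) (by
    rw [Finset.sum_coe_sort s fun i => ENNReal.ofReal (w i),
      ← ENNReal.ofReal_sum_of_nonneg hw, hw1, ENNReal.ofReal_one])
  let e : s → Admissible p := fun i => ⟨(o, z i), hz i i.2⟩
  have he : Measurable e := fun _ _ => trivial
  refine ⟨q.toMeasure.map e, Measure.isProbabilityMeasure_map he.aemeasurable, ?_, ?_⟩
  · intro φ hφ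
    rw [lintegral_map (by fun_prop) he]
    simp [e]
  · rw [integral_map he.aemeasurable (measurable_decision p).aestronglyMeasurable, PMF.integral_eq_sum,
      Finset.centerMass_eq_of_sum_1 _ _ hw1, ← Finset.sum_coe_sort s (fun i => w i • z i)]
    refine Finset.sum_congr rfl fun i _ => ?_
    simp [q, e, ENNReal.toReal_ofReal (hw i i.2)]

/-- Draw state and decision jointly and independently in each slot: the state from `p.prob`, then a
decision whose conditional mean is the prescribed point of the hull. The product space of these
pairs carries the policy. -/
theorem Standing.exists_policy (hp : p.Standing Mf Mg) {v : EuclideanSpace ℝ (Fin I)}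
    (hv : v ∈ p.Xbar) :
    ∃ (Ω' : Type u) (_ : MeasurableSpace Ω') (P : Measure Ω')
      (st : ℕ → Ω' → Ω) (x : ℕ → Ω' → EuclideanSpace ℝ (Fin I)),
      IsProbabilityMeasure P ∧ p.IsPolicy P st x ∧ ∀ t, ∫ a, x t a ∂P = v := by
  obtain ⟨xs, hxs, rfl⟩ := hv
  obtain ⟨R, hR0, hR⟩ := hp.exists_X_radius
  choose κ hκ hst hmean using fun o => exists_decision_law (hxs o)
  let k : Kernel Ω (Admissible p) := ⟨κ, Measurable.of_discrete⟩
  have : IsMarkovKernel k := ⟨hκ⟩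
  let μ : Measure (Admissible p) := p.prob.toMeasure.bind k
  have : IsProbabilityMeasure μ := by dsimp only [μ]; infer_instance
  have hlaw : μ.map (fun q => q.1.1) = p.prob.toMeasure := by
    ext s hs
    rw [Measure.map_apply (by fun_prop) hs,
      Measure.bind_apply ((by fun_prop : Measurable fun q : Admissible p => q.1.1) hs)
        k.measurable.aemeasurable]
    rw [← lintegral_indicator_one hs]
    refine lintegral_congr fun o => ?_
    rw [← hst o _ (measurable_one.indicator hs), ← lintegral_indicator_one
      ((by fun_prop : Measurable fun q : Admissible p => q.1.1) hs)]
    rfl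
  have hint : Integrable (fun q : Admissible p => q.1.2) μ :=
    Integrable.of_bound (measurable_decision p).aestronglyMeasurable R
      (ae_of_all _ fun q => hR _ _ q.2)
  have hmn : ∫ q, q.1.2 ∂μ = ∑' o, p.wt o • xs o := by
    have := Kernel.integral_comp (η := k) (κ := Kernel.const Unit p.prob.toMeasure) (a := ())
      (by rwa [← Measure.comp_eq_comp_const_apply])
    rw [← Measure.comp_eq_comp_const_apply, Kernel.const_apply] at this
    rw [this]
    have h2 : ∀ o, ∫ q, q.1.2 ∂(k o) = xs o := hmean
    simp only [h2]
    exact PMF.integral_eq_tsum p.prob xs (hp.integrable_selection hxs)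
  refine ⟨ℕ → Admissible p, inferInstance, Measure.infinitePi fun _ => μ,
    fun t a => (a t).1.1, fun t a => (a t).1.2, inferInstance, ⟨⟨?_, ?_, ?_⟩, ?_, ?_⟩, ?_⟩
  · intro t; fun_prop
  · intro t
    rw [← hlaw, ← Measure.infinitePi_map_eval (fun _ : ℕ => μ) t,
      Measure.map_map (by fun_prop) (by fun_prop), Measure.infinitePi_map_eval]
    rfl
  · intro t
    have h1 := iIndepFun_infinitePi (P := fun _ : ℕ => μ) (X := fun _ q => q)
      fun _ => measurable_id
    have h2 := indep_iSup_of_disjoint (fun t => (measurable_pi_apply t).comap_le) h1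
      (S := {t}) (T := Set.Iio t) (by simp)
    refine indep_of_indep_of_le_left (indep_of_indep_of_le_right h2 ?_) ?_
    · refine iSup₂_mono fun s _ => ?_
      change MeasurableSpace.comap
        ((fun q : Admissible p => q.1) ∘ fun a : ℕ → Admissible p => a s) _ ≤ _
      rw [← MeasurableSpace.comap_comp]
      exact MeasurableSpace.comap_mono measurable_subtype_coe.comap_le
    · rw [iSup_singleton]
      change MeasurableSpace.comap
        ((fun q : Admissible p => q.1.1) ∘ fun a : ℕ → Admissible p => a t) _ ≤ _
      rw [← MeasurableSpace.comap_comp]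
      exact MeasurableSpace.comap_mono (measurable_fst.comp measurable_subtype_coe).comap_le
  · intro t; fun_prop
  · intro t a; exact (a t).2
  · intro t
    have h1 := integral_map (μ := Measure.infinitePi fun _ : ℕ => μ)
      (measurable_pi_apply t).aemeasurable (measurable_decision p).aestronglyMeasurable
    rw [Measure.infinitePi_map_eval, hmn] at h1
    exact h1.symm

/-- Weak duality: the dual function is a lower bound on the optimal cost. -/
theorem Standing.dual_le_fopt (hp : p.Standing Mf Mg) {l : MultVec I J}
    (hl : DualFeasible l) : p.dual l ≤ p.fopt := by
  refine le_csInf ?_ ?_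
  -- The stationary policy with mean the Slater point is feasible, so the infimum is over a nonempty
  -- set.
  · obtain ⟨v, hv, hg⟩ := hp.slater
    obtain ⟨Ω', mΩ', P, st, x, hP, hpol, hx⟩ := hp.exists_policy (interior_subset hv)
    refine ⟨_, Ω', mΩ', P, st, x, hP, hpol, fun j => ?_, rfl⟩
    -- At T = 0 the average is the default value 0, so the equality is only eventual.
    have : ∀ᶠ T : ℕ in atTop, p.g j (meanAvg P x T) = p.g j v := by
      filter_upwards [eventually_gt_atTop 0] with T hT
      have hT' : (T : ℝ) ≠ 0 := by positivity
      simp only [meanAvg, hx, Finset.sum_const, Finset.card_range, ← Nat.cast_smul_eq_nsmul ℝ,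
        smul_smul, inv_mul_cancel₀ hT', one_smul]
    rw [limsup_congr this, limsup_const]
    exact (hg j).le
  · rintro _ ⟨Ω', mΩ', P, st, x, hP, hpol, hg, rfl⟩
    exact hpol.dual_le_limsup hp hl hg

end TAProblem

/-! ### One-slot drift of the queues. -/

section MultVec

variable {I J : ℕ}

theorem norm_multVec_sub_sq (w : EuclideanSpace ℝ (Fin J)) (z : EuclideanSpace ℝ (Fin I))
    (c : MultVec I J) :
    ‖multVec w z - c‖ ^ 2 = ∑ j, (w j - c.fst j) ^ 2 + ‖z - c.snd‖ ^ 2 := by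
  rw [WithLp.prod_norm_sq_eq_of_L2, EuclideanSpace.norm_sq_eq]
  simp [multVec]

theorem abs_sub_le_norm_multVec_sub (w : EuclideanSpace ℝ (Fin J))
    (z : EuclideanSpace ℝ (Fin I)) (c : MultVec I J) (j : Fin J) :
    |w j - c.fst j| ≤ ‖multVec w z - c‖ := by
  refine abs_le_of_sq_le_sq ?_ (norm_nonneg _)
  rw [norm_multVec_sub_sq]
  have := Finset.single_le_sum (f := fun j => (w j - c.fst j) ^ 2)
    (fun j _ => sq_nonneg _) (Finset.mem_univ j)
  linarith [sq_nonneg ‖z - c.snd‖]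

theorem norm_sub_le_norm_multVec_sub (w : EuclideanSpace ℝ (Fin J))
    (z : EuclideanSpace ℝ (Fin I)) (c : MultVec I J) :
    ‖z - c.snd‖ ≤ ‖multVec w z - c‖ := by
  refine (pow_le_pow_iff_left₀ (norm_nonneg _) (norm_nonneg _) two_ne_zero).1 ?_
  rw [norm_multVec_sub_sq]
  linarith [Finset.sum_nonneg fun j (_ : j ∈ Finset.univ) => sq_nonneg (w j - c.fst j)]

end MultVec

namespace TAProblem

variable {Ω : Type u} {I J : ℕ} {p : TAProblem Ω I J} {Mf : ℝ} {Mg : Fin J → ℝ}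
variable [MeasurableSpace Ω]

variable (p) in
/-- Deviation of `min_{x ∈ X_ω} ⟪z, x⟫` from its mean over the states. -/
def minDev (o : Ω) (z : EuclideanSpace ℝ (Fin I)) : ℝ := minInner (p.X o) z - p.meanMin z

namespace IsRun

variable {Ω' : Type*} [MeasurableSpace Ω'] {P : Measure Ω'} {V : ℝ}
  {W0 : EuclideanSpace ℝ (Fin J)} {Z0 : EuclideanSpace ℝ (Fin I)}
  {st : ℕ → Ω' → Ω} {x y : ℕ → Ω' → EuclideanSpace ℝ (Fin I)}
  {W : ℕ → Ω' → EuclideanSpace ℝ (Fin J)} {Z : ℕ → Ω' → EuclideanSpace ℝ (Fin I)}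

theorem W_nonneg (hr : p.IsRun V W0 Z0 P st x y W Z) (t : ℕ) (a : Ω') (j : Fin J) :
    0 ≤ W t a j := by
  cases t with
  | zero => rw [hr.W_zero]; exact hr.W0_nonneg j
  | succ t => rw [hr.W_succ]; exact le_max_right _ _

/-- As W ≥ 0, taking the positive part moves each coordinate by at most |g_j(y)|; the total squared
displacement is then at most 2C. -/
theorem norm_succ_sub_le (hp : p.Standing Mf Mg) (hr : p.IsRun V W0 Z0 P st x y W Z)
    (t : ℕ) (a : Ω') (c : MultVec I J) :
    |‖multVec (W (t + 1) a) (Z (t + 1) a) - c‖ - ‖multVec (W t a) (Z t a) - c‖|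
      ≤ √(2 * p.driftConst) := by
  refine (abs_norm_sub_norm_le _ _).trans (Real.le_sqrt_of_sq_le ?_)
  rw [sub_sub_sub_cancel_right, norm_multVec_sub_sq]
  refine le_trans ?_ (hp.drift_le (hp.X_subset _ (hr.x_mem t a)) (hr.y_mem t a))
  refine add_le_add (Finset.sum_le_sum fun j _ => ?_) (le_of_eq ?_)
  · change (W (t + 1) a j - W t a j) ^ 2 ≤ _
    have hW := hr.W_nonneg t a j
    rw [hr.W_succ]
    rcases le_total (W t a j + p.g j (y t a)) 0 with h | h
    · rw [max_eq_right h]; nlinarith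
    · rw [max_eq_left h]; nlinarith
  · change ‖Z (t + 1) a - Z t a‖ ^ 2 = _
    rw [hr.Z_succ]
    congr 2
    abel

/-- The positive part is the projection onto the half-line that contains c_j, so it does not
increase the distance to c_j; the rest is expanding a square. -/
theorem norm_succ_sub_sq_le (hp : p.Standing Mf Mg) (hr : p.IsRun V W0 Z0 P st x y W Z)
    (t : ℕ) (a : Ω') {c : MultVec I J} (hc : DualFeasible c) :
    ‖multVec (W (t + 1) a) (Z (t + 1) a) - c‖ ^ 2
      ≤ ‖multVec (W t a) (Z t a) - c‖ ^ 2 + 2 * p.driftConst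
        + 2 * (∑ j, (W t a j - c.fst j) * p.g j (y t a)
          + inner ℝ (Z t a - c.snd) (x t a - y t a)) := by
  rw [norm_multVec_sub_sq, norm_multVec_sub_sq]
  have h1 := hp.drift_le (hp.X_subset _ (hr.x_mem t a)) (hr.y_mem t a)
  have h2 : ∑ j, (W (t + 1) a j - c.fst j) ^ 2 ≤ ∑ j, (W t a j - c.fst j) ^ 2
      + 2 * ∑ j, (W t a j - c.fst j) * p.g j (y t a) + ∑ j, p.g j (y t a) ^ 2 := by
    rw [Finset.mul_sum, ← Finset.sum_add_distrib, ← Finset.sum_add_distrib]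
    refine Finset.sum_le_sum fun j _ => ?_
    have hW := hr.W_nonneg t a j
    have hj := hc j
    rw [hr.W_succ]
    rcases le_total (W t a j + p.g j (y t a)) 0 with h | h
    · rw [max_eq_right h]; nlinarith
    · rw [max_eq_left h]; nlinarith
  have h3 : ‖Z (t + 1) a - c.snd‖ ^ 2 = ‖Z t a - c.snd‖ ^ 2
      + 2 * inner ℝ (Z t a - c.snd) (x t a - y t a) + ‖x t a - y t a‖ ^ 2 := by
    rw [← norm_add_sq_real, hr.Z_succ]
    congr 2
    abel
  linarith

variable [Countable Ω] [MeasurableSingletonClass Ω]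

omit [Countable Ω] [MeasurableSingletonClass Ω] in
theorem minInner_scaled (hp : p.Standing Mf Mg) (hr : p.IsRun V W0 Z0 P st x y W Z)
    (hV : 0 < V) (t : ℕ) (a : Ω') :
    V * minInner (p.X (st t a)) (V⁻¹ • Z t a) = inner ℝ (Z t a) (x t a) := by
  obtain ⟨R, hR0, hR⟩ := hp.exists_X_radius
  rw [minInner_smul_eq (hR _) (hr.x_mem t a) (hr.x_min t a) (inv_nonneg.2 hV.le)]
  field_simp

omit [Countable Ω] [MeasurableSingletonClass Ω] in
theorem dualFeasible_scaled (hr : p.IsRun V W0 Z0 P st x y W Z)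
    (hV : 0 < V) (t : ℕ) (a : Ω') :
    DualFeasible (V⁻¹ • multVec (W t a) (Z t a)) := fun j =>
  mul_nonneg (inv_nonneg.2 hV.le) (hr.W_nonneg t a j)

/-- The decisions of the algorithm minimize the Lagrangian at the scaled queues. -/
theorem le_dual_scaled (hp : p.Standing Mf Mg) (hr : p.IsRun V W0 Z0 P st x y W Z)
    (hV : 0 < V) (t : ℕ) (a : Ω') :
    V * p.f (y t a) + ∑ j, W t a j * p.g j (y t a) + inner ℝ (Z t a) (x t a - y t a)
      ≤ V * p.dual (V⁻¹ • multVec (W t a) (Z t a)) + V * p.minDev (st t a) (V⁻¹ • Z t a) := by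
  have key : ∀ y' : EuclideanSpace ℝ (Fin I),
      p.f y' + ∑ j, (V⁻¹ • multVec (W t a) (Z t a)).fst j * p.g j y'
        - inner ℝ (V⁻¹ • multVec (W t a) (Z t a)).snd y'
      = V⁻¹ * (V * p.f y' + ∑ j, W t a j * p.g j y' - inner ℝ (Z t a) y') := by
    intro y'
    have e1 : ∀ j, (V⁻¹ • multVec (W t a) (Z t a)).fst j = V⁻¹ * W t a j := fun j => rfl
    have e2 : (V⁻¹ • multVec (W t a) (Z t a)).snd = V⁻¹ • Z t a := rfl
    simp only [e1, e2, real_inner_smul_left, mul_assoc, ← Finset.mul_sum]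
    field_simp
  have h := hp.le_dual (V⁻¹ • multVec (W t a) (Z t a))
    (q := V⁻¹ * (V * p.f (y t a) + ∑ j, W t a j * p.g j (y t a) - inner ℝ (Z t a) (y t a)))
    fun y' hy' => by
      rw [key]
      exact mul_le_mul_of_nonneg_left (hr.y_min t a y' hy') (inv_nonneg.2 hV.le)
  have h' := mul_le_mul_of_nonneg_left h hV.le
  rw [mul_add, ← mul_assoc, mul_inv_cancel₀ hV.ne', one_mul] at h'
  have e2 : (V⁻¹ • multVec (W t a) (Z t a)).snd = V⁻¹ • Z t a := rfl
  rw [e2] at h'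
  have h3 := hr.minInner_scaled hp hV t a
  rw [minDev, mul_sub, h3, inner_sub_right]
  linarith

/-- One-slot drift of the squared distance of the queues to `V l`. -/
theorem sq_drift_le (hp : p.Standing Mf Mg) (hr : p.IsRun V W0 Z0 P st x y W Z)
    (hV : 0 < V) {l : MultVec I J} (hl : DualFeasible l) (t : ℕ) (a : Ω') :
    ‖multVec (W (t + 1) a) (Z (t + 1) a) - V • l‖ ^ 2
      ≤ ‖multVec (W t a) (Z t a) - V • l‖ ^ 2 + 2 * p.driftConst
        + 2 * V * (p.dual (V⁻¹ • multVec (W t a) (Z t a)) - p.dual l)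
        + 2 * (V * (p.minDev (st t a) (V⁻¹ • Z t a) - p.minDev (st t a) l.snd)) := by
  have h0 := hr.norm_succ_sub_sq_le hp t a (c := V • l) fun j => mul_nonneg hV.le (hl j)
  have h1 := hr.le_dual_scaled hp hV t a
  -- The actual decisions are only a competitor for the Lagrangian at l, whereas they are optimal at
  -- Q/V. Subtracting the two comparisons cancels f(y) and leaves the dual gap and the two
  -- deviations.
  have h2 := mul_le_mul_of_nonneg_left (hp.dual_le l (hr.y_mem t a)) hV.le
  obtain ⟨R, hR0, hR⟩ := hp.exists_X_radius
  have h3 := mul_le_mul_of_nonneg_left (minInner_le (hR _) l.snd (hr.x_mem t a)) hV.le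
  have e1 : ∀ j, (V • l).fst j = V * l.fst j := fun j => rfl
  have e2 : (V • l).snd = V • l.snd := rfl
  rw [e2] at h0
  simp only [e1, sub_mul, Finset.sum_sub_distrib, inner_sub_left, real_inner_smul_left,
    mul_assoc, ← Finset.mul_sum] at h0
  simp only [inner_sub_right] at h0 h1
  simp only [minDev] at h1 ⊢
  linarith

/-- One-slot drift-plus-penalty bound. -/
theorem objective_le (hp : p.Standing Mf Mg) (hr : p.IsRun V W0 Z0 P st x y W Z)
    (hV : 0 < V) (t : ℕ) (a : Ω') :
    V * p.f (y t a) ≤ V * p.fopt + p.driftConst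
      + (‖multVec (W t a) (Z t a)‖ ^ 2 - ‖multVec (W (t + 1) a) (Z (t + 1) a)‖ ^ 2) / 2
      + V * p.minDev (st t a) (V⁻¹ • Z t a) := by
  -- The drift is taken about the origin here, so that weak duality at Q/V alone brings in the
  -- optimal cost.
  have h0 := hr.norm_succ_sub_sq_le hp t a (c := 0) fun j => le_rfl
  have h1 := hr.le_dual_scaled hp hV t a
  have h2 := mul_le_mul_of_nonneg_left (hp.dual_le_fopt (hr.dualFeasible_scaled hV t a)) hV.le
  have e1 : ∀ j, (0 : MultVec I J).fst j = 0 := fun j => rfl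
  have e2 : (0 : MultVec I J).snd = 0 := rfl
  simp only [sub_zero, e1, e2] at h0
  linarith

end IsRun

omit [MeasurableSpace Ω]

theorem dist_scaled {V : ℝ} (hV : 0 < V) (q l : MultVec I J) :
    ‖V⁻¹ • q - l‖ = ‖q - V • l‖ / V := by
  have : V⁻¹ • q - l = V⁻¹ • (q - V • l) := by
    rw [smul_sub, smul_smul, inv_mul_cancel₀ hV.ne', one_smul]
  rw [this, norm_smul, norm_inv, Real.norm_of_nonneg hV.le, inv_mul_eq_div]

/-- The dual gap outside the ball of radius `B_G(V)`. -/
theorem dual_gap_ge {l m : MultVec I J} {S L L' V C : ℝ} (hC : 0 < C)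
    (hlnp : p.LocallyNonPolyhedral l S L L') (hm : DualFeasible m) (hV : 0 < V)
    (hB' : bG' C L' ≤ S * V) (hsV : 2 / L' ≤ √V) (hK : bG C L V ≤ V * ‖m - l‖) :
    2 * C + 2 * V * (p.dual m - p.dual l) ≤ -(2 * (V * ‖m - l‖) / √V) := by
  obtain ⟨hS, hL, hL', h1, h2⟩ := hlnp
  have hs : 0 < √V := Real.sqrt_pos.2 hV
  have hss : √V * √V = V := Real.mul_self_sqrt hV.le
  set d := ‖m - l‖
  rcases le_or_gt d S with hd | hd
  · have h := h1 m hm hd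
    -- The left side is the positive root of L w² = C + w. Beyond it, with w = √V d, quadratic
    -- growth absorbs C and still leaves the drift −2w.
    have hu : (1 + √(1 + 4 * L * C)) / (2 * L) ≤ √V * d := by
      have := (le_max_right _ _).trans hK
      exact le_of_mul_le_mul_left (this.trans_eq (by rw [← mul_assoc, hss])) hs
    set q := √(1 + 4 * L * C)
    have hq : q ^ 2 = 1 + 4 * L * C := Real.sq_sqrt (by positivity)
    have hq0 : 0 ≤ q := Real.sqrt_nonneg _
    rw [div_le_iff₀ (by positivity)] at hu
    have e1 : 2 * (V * d) / √V = 2 * (√V * d) := by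
      rw [div_eq_iff hs.ne']; linear_combination -2 * d * hss
    rw [e1]
    have e2 : V * (L * d ^ 2) = L * (√V * d) ^ 2 := by
      linear_combination (-L * d ^ 2) * hss
    have h4 : C + √V * d ≤ L * (√V * d) ^ 2 := by
      set w := √V * d
      have : q ^ 2 ≤ (2 * L * w - 1) ^ 2 := pow_le_pow_left₀ hq0 (by linarith) 2
      have : 4 * L * (C + w) ≤ 4 * L * (L * w ^ 2) := by nlinarith
      exact le_of_mul_le_mul_left this (by positivity)
    have h5 := mul_le_mul_of_nonneg_left h hV.le
    nlinarith
  · have h := mul_le_mul_of_nonneg_left (h2 m hm hd) hV.le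
    -- In the far region half of the linear growth 2V L' d absorbs 2C; the other half is at least 2V
    -- d/√V because √V ≥ 2/L'.
    have h3 : 2 * C / L' ≤ V * d :=
      ((le_max_right _ _).trans hB').trans (by rw [mul_comm]; gcongr)
    rw [div_le_iff₀ hL'] at h3
    rw [div_le_iff₀ hL'] at hsV
    have h4 : 2 * (V * d) / √V ≤ V * d * L' := by
      rw [div_le_iff₀ hs]
      have : 0 ≤ V * d := by positivity
      nlinarith
    nlinarith

end TAProblem

/-! ### The past, conditioning, and noise of mean zero. -/

section Past

variable {Ω' H : Type*} [MeasurableSpace H] {h : ℕ → Ω' → H}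

theorem pastSigma_mono {s t : ℕ} (hst : s ≤ t) : pastSigma h s ≤ pastSigma h t :=
  biSup_mono fun _ hi => lt_of_lt_of_le hi hst

theorem measurable_pastSigma_succ (t : ℕ) : Measurable[pastSigma h (t + 1)] (h t) :=
  measurable_iff_comap_le.2 (le_biSup (fun s => MeasurableSpace.comap (h s) inferInstance)
    (show t ∈ Set.Iio (t + 1) from Nat.lt_succ_self t))

theorem pastSigma_le [m : MeasurableSpace Ω'] (hh : ∀ t, Measurable (h t)) (t : ℕ) :
    pastSigma h t ≤ m :=
  iSup₂_le fun s _ => (hh s).comap_le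

end Past

/-- From slot `s` on, the states have law `prob` and are independent of the past under `ν`. -/
structure IsTailStateProcess {Ω : Type*} [MeasurableSpace Ω] (prob : PMF Ω)
    {Ω' H : Type*} [MeasurableSpace Ω'] [MeasurableSpace H] (ν : Measure Ω')
    (st : ℕ → Ω' → Ω) (h : ℕ → Ω' → H) (s : ℕ) : Prop where
  law : ∀ t, s ≤ t → ν.map (st t) = prob.toMeasure
  indep : ∀ t, s ≤ t → Indep (MeasurableSpace.comap (st t) inferInstance) (pastSigma h t) ν

/-- Conditioning on an event of the past of slot `s` preserves the law of the states from `s`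
on. -/
theorem IsStateProcess.cond {Ω : Type*} [MeasurableSpace Ω] {prob : PMF Ω}
    {Ω' H : Type*} [MeasurableSpace Ω'] [MeasurableSpace H] {P : Measure Ω'}
    [IsProbabilityMeasure P] {st : ℕ → Ω' → Ω} {h : ℕ → Ω' → H}
    (hs : IsStateProcess prob P st h) (hh : ∀ t, Measurable (h t)) {s : ℕ} {A : Set Ω'}
    (hA : MeasurableSet[pastSigma h s] A) (hA0 : P A ≠ 0) :
    IsTailStateProcess prob (P[|A]) st h s := by
  have hAm : MeasurableSet A := pastSigma_le hh s A hA
  -- The event A belongs to the past of every t ≥ s, hence is independent of the state of slot t.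
  -- For joint independence below, A ∩ D is again an event of that past.
  have hlaw : ∀ t, s ≤ t → ∀ B, MeasurableSet[MeasurableSpace.comap (st t) inferInstance] B →
      P[|A] B = P B := by
    intro t ht B hB
    rw [cond_apply hAm, Set.inter_comm,
      (Indep_iff _ _ _).1 (hs.indep t) B A hB (pastSigma_mono ht A hA), mul_comm, mul_assoc,
      ENNReal.mul_inv_cancel hA0 (measure_ne_top _ _), mul_one]
  refine ⟨fun t ht => ?_, fun t ht => ?_⟩
  · ext B hB
    rw [← hs.law t, Measure.map_apply (hs.measurable t) hB,
      Measure.map_apply (hs.measurable t) hB, hlaw t ht _ ⟨B, hB, rfl⟩]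
  · rw [Indep_iff]
    intro B D hB hD
    rw [hlaw t ht B hB, cond_apply hAm, cond_apply hAm, ← Set.inter_assoc, Set.inter_comm A B,
      Set.inter_assoc, (Indep_iff _ _ _).1 (hs.indep t) B (A ∩ D) hB
        (MeasurableSet.inter (pastSigma_mono ht A hA) hD), mul_left_comm]

/-- A function of a random variable `σ` and of the past whose mean over `σ` vanishes is
uncorrelated with the past, if `σ` is independent of the past. -/
theorem integral_mul_eq_zero_of_indep {S E Ω' : Type*} [MeasurableSpace S] [MeasurableSpace E]
    {F m : MeasurableSpace Ω'} {ν : Measure Ω'} [IsProbabilityMeasure ν] {σ : Ω' → S}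
    {φ : Ω' → ℝ} {ζ : Ω' → E} {D : S → E → ℝ} (hσ : Measurable σ) (hF : F ≤ m)
    (hind : Indep (MeasurableSpace.comap σ inferInstance) F ν)
    (hφ : Measurable[F] φ) (hζ : Measurable[F] ζ) (hD : Measurable fun q : S × E => D q.1 q.2)
    (h0 : ∀ z, ∫ o, D o z ∂(ν.map σ) = 0)
    (hi : Integrable (fun a => φ a * D (σ a) (ζ a)) ν) :
    ∫ a, φ a * D (σ a) (ζ a) ∂ν = 0 := by
  -- The joint law of σ and (φ, ζ) is a product, so Fubini's theorem can integrate over σ first,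
  -- where the mean vanishes.
  have hind' : IndepFun σ (fun a => (φ a, ζ a)) ν :=
    indep_of_indep_of_le_right hind (Measurable.prodMk hφ hζ).comap_le
  have hφ' : Measurable φ := hφ.mono hF le_rfl
  have hζ' : Measurable ζ := hζ.mono hF le_rfl
  have hφζ : Measurable (fun a => (φ a, ζ a)) := hφ'.prodMk hζ'
  have hpair : Measurable (fun a => (σ a, (φ a, ζ a))) := hσ.prodMk hφζ
  have hmap := (indepFun_iff_map_prod_eq_prod_map_map hσ.aemeasurable hφζ.aemeasurable).1 hind'
  have hm : Measurable fun q : S × (ℝ × E) => q.2.1 * D q.1 q.2.2 :=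
    (measurable_fst.comp measurable_snd).mul
      (hD.comp (measurable_fst.prodMk (measurable_snd.comp measurable_snd)))
  have hi' : Integrable (fun q : S × (ℝ × E) => q.2.1 * D q.1 q.2.2)
      (ν.map fun a => (σ a, (φ a, ζ a))) :=
    (integrable_map_measure hm.aestronglyMeasurable hpair.aemeasurable).2 hi
  have he := integral_map (μ := ν) hpair.aemeasurable hm.aestronglyMeasurable
  rw [hmap] at hi' he
  have := Measure.isProbabilityMeasure_map (μ := ν) hφζ.aemeasurable
  have := Measure.isProbabilityMeasure_map (μ := ν) hσ.aemeasurable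
  have h1 := integral_prod_symm _ hi'
  have h2 : ∀ q : ℝ × E, ∫ o, q.1 * D o q.2 ∂(ν.map σ) = 0 := fun q => by
    rw [integral_const_mul, h0, mul_zero]
  simp only [h2, integral_zero] at h1
  rw [h1] at he
  exact he.symm

theorem measurable_norm_multVec_sub {Ω' : Type*} {F : MeasurableSpace Ω'} {I J : ℕ}
    {W : Ω' → EuclideanSpace ℝ (Fin J)} {Z : Ω' → EuclideanSpace ℝ (Fin I)}
    (hW : ∀ j, Measurable fun a => W a j) (hZ : Measurable Z) (c : MultVec I J) :
    Measurable fun a => ‖multVec (W a) (Z a) - c‖ := by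
  have : (fun a => ‖multVec (W a) (Z a) - c‖)
      = fun a => √(∑ j, (W a j - c.fst j) ^ 2 + ‖Z a - c.snd‖ ^ 2) :=
    funext fun a => by rw [← norm_multVec_sub_sq, Real.sqrt_sq (norm_nonneg _)]
  rw [this]
  have h1 : Measurable fun a => ∑ j, (W a j - c.fst j) ^ 2 :=
    Finset.measurable_sum _ fun j _ => ((hW j).sub measurable_const).pow_const 2
  have h2 : Measurable fun a => ‖Z a - c.snd‖ ^ 2 :=
    ((hZ.sub measurable_const).norm).pow_const 2
  exact (h1.add h2).sqrt

namespace TAProblem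

variable {Ω : Type u} {I J : ℕ} {p : TAProblem Ω I J} {Mf : ℝ} {Mg : Fin J → ℝ}
variable [MeasurableSpace Ω] [Countable Ω] [MeasurableSingletonClass Ω]

namespace Standing

variable (hp : p.Standing Mf Mg)
include hp

theorem measurable_minInner :
    Measurable fun q : Ω × EuclideanSpace ℝ (Fin I) => minInner (p.X q.1) q.2 := by
  obtain ⟨R, hR0, hR⟩ := hp.exists_X_radius
  exact measurable_from_prod_countable_right fun o =>
    (continuous_minInner (hR o) hR0 (hp.X_nonempty o)).measurable

theorem measurable_meanMin : Measurable p.meanMin :=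
  (hp.measurable_minInner.stronglyMeasurable.integral_prod_left'
    (μ := p.prob.toMeasure)).measurable

theorem measurable_minDev :
    Measurable fun q : Ω × EuclideanSpace ℝ (Fin I) => p.minDev q.1 q.2 :=
  hp.measurable_minInner.sub (hp.measurable_meanMin.comp measurable_snd)

theorem integral_minDev (z : EuclideanSpace ℝ (Fin I)) :
    ∫ o, p.minDev o z ∂p.prob.toMeasure = 0 := by
  unfold minDev
  rw [integral_sub (hp.integrable_minInner z) (integrable_const _)]
  simp [meanMin]

omit [Countable Ω] [MeasurableSingletonClass Ω] in
theorem exists_abs_minDev_le : ∃ R, 0 ≤ R ∧ ∀ o z, |p.minDev o z| ≤ ‖z‖ * R := by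
  obtain ⟨R, hR0, hR⟩ := hp.exists_X_radius
  refine ⟨2 * R, by positivity, fun o z => ?_⟩
  have h1 := abs_minInner_le (hR o) (hp.X_nonempty o) z
  have h2 : |p.meanMin z| ≤ ‖z‖ * R := by
    have := norm_integral_le_of_norm_le_const (μ := p.prob.toMeasure) (C := ‖z‖ * R)
      (ae_of_all _ fun o => (Real.norm_eq_abs _).trans_le
        (abs_minInner_le (hR o) (hp.X_nonempty o) z))
    simpa [meanMin] using this
  have := abs_sub (minInner (p.X o) z) (p.meanMin z)
  unfold minDev
  linarith

variable {Ω' : Type*} [m : MeasurableSpace Ω'] {ν : Measure Ω'}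
  [IsProbabilityMeasure ν] {σ : Ω' → Ω} {φ : Ω' → ℝ} {ζ : Ω' → EuclideanSpace ℝ (Fin I)}
  {b r : ℝ}

theorem integrable_mul_minDev (hσ : Measurable σ) (hφ : Measurable φ) (hζ : Measurable ζ)
    (hb : ∀ a, |φ a| ≤ b) (hr : ∀ a, ‖ζ a‖ ≤ r) :
    Integrable (fun a => φ a * p.minDev (σ a) (ζ a)) ν := by
  obtain ⟨R, hR0, hR⟩ := hp.exists_abs_minDev_le
  refine Integrable.of_bound
    (hφ.mul (hp.measurable_minDev.comp (hσ.prodMk hζ))).aestronglyMeasurable (b * (r * R))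
    (ae_of_all _ fun a => ?_)
  rw [Real.norm_eq_abs, abs_mul]
  refine mul_le_mul (hb a) ((hR _ _).trans (mul_le_mul_of_nonneg_right (hr a) hR0))
    (abs_nonneg _) ((abs_nonneg _).trans (hb a))

/-- The deviation in a fresh state has mean zero, conditionally on the past. -/
theorem integral_mul_minDev {Ω' : Type*} {F m : MeasurableSpace Ω'} {ν : Measure Ω'}
    [IsProbabilityMeasure ν] {σ : Ω' → Ω} {φ : Ω' → ℝ} {ζ : Ω' → EuclideanSpace ℝ (Fin I)}
    {b r : ℝ} (hσ : Measurable σ) (hlaw : ν.map σ = p.prob.toMeasure)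
    (hF : F ≤ m) (hind : Indep (MeasurableSpace.comap σ inferInstance) F ν)
    (hφ : Measurable[F] φ) (hζ : Measurable[F] ζ) (hb : ∀ a, |φ a| ≤ b)
    (hr : ∀ a, ‖ζ a‖ ≤ r) :
    ∫ a, φ a * p.minDev (σ a) (ζ a) ∂ν = 0 := by
  refine integral_mul_eq_zero_of_indep hσ hF hind hφ hζ hp.measurable_minDev ?_
    (hp.integrable_mul_minDev hσ (hφ.mono hF le_rfl) (hζ.mono hF le_rfl) hb hr)
  intro z
  rw [hlaw]
  exact hp.integral_minDev z

end Standing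

namespace IsRun

variable {Ω' : Type*} [m : MeasurableSpace Ω'] {P : Measure Ω'} {V : ℝ}
  {W0 : EuclideanSpace ℝ (Fin J)} {Z0 : EuclideanSpace ℝ (Fin I)}
  {st : ℕ → Ω' → Ω} {x y : ℕ → Ω' → EuclideanSpace ℝ (Fin I)}
  {W : ℕ → Ω' → EuclideanSpace ℝ (Fin J)} {Z : ℕ → Ω' → EuclideanSpace ℝ (Fin I)}

section Measurability

omit [Countable Ω] [MeasurableSingletonClass Ω]

theorem measurable_history (hr : p.IsRun V W0 Z0 P st x y W Z) (t : ℕ) :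
    Measurable fun a => (st t a, x t a, y t a) :=
  (hr.states.measurable t).prodMk ((hr.measurable_x t).prodMk (hr.measurable_y t))

theorem past_le (hr : p.IsRun V W0 Z0 P st x y W Z) (t : ℕ) :
    pastSigma (fun t a => (st t a, x t a, y t a)) t ≤ m :=
  pastSigma_le hr.measurable_history t

omit m in
theorem measurable_x_past (x y : ℕ → Ω' → EuclideanSpace ℝ (Fin I)) (st : ℕ → Ω' → Ω) (t : ℕ) :
    Measurable[pastSigma (fun t a => (st t a, x t a, y t a)) (t + 1)] (x t) :=
  (measurable_fst.comp measurable_snd).comp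
    (measurable_pastSigma_succ (h := fun t a => (st t a, x t a, y t a)) t)

omit m in
theorem measurable_y_past (x y : ℕ → Ω' → EuclideanSpace ℝ (Fin I)) (st : ℕ → Ω' → Ω) (t : ℕ) :
    Measurable[pastSigma (fun t a => (st t a, x t a, y t a)) (t + 1)] (y t) :=
  (measurable_snd.comp measurable_snd).comp
    (measurable_pastSigma_succ (h := fun t a => (st t a, x t a, y t a)) t)

theorem measurable_Z_past (hr : p.IsRun V W0 Z0 P st x y W Z) (t : ℕ) :
    Measurable[pastSigma (fun t a => (st t a, x t a, y t a)) t] (Z t) := by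
  induction t with
  | zero =>
    have : Z 0 = fun _ => Z0 := funext hr.Z_zero
    rw [this]
    exact measurable_const
  | succ t ih =>
    have : Z (t + 1) = fun a => Z t a + x t a - y t a := funext (hr.Z_succ t)
    rw [this]
    exact ((ih.mono (pastSigma_mono t.le_succ) le_rfl).add (measurable_x_past x y st t)).sub
      (measurable_y_past x y st t)

theorem measurable_W_past (hp : p.Standing Mf Mg) (hr : p.IsRun V W0 Z0 P st x y W Z) (t : ℕ)
    (j : Fin J) :
    Measurable[pastSigma (fun t a => (st t a, x t a, y t a)) t] fun a => W t a j := by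
  induction t with
  | zero =>
    have : (fun a => W 0 a j) = fun _ => W0 j := funext fun a => by rw [hr.W_zero]
    rw [this]
    exact measurable_const
  | succ t ih =>
    obtain ⟨G, hG, hGe⟩ := hp.exists_extension_g j
    have : (fun a => W (t + 1) a j) = fun a => max (W t a j + G (y t a)) 0 :=
      funext fun a => by rw [hr.W_succ, hGe (Or.inl (hr.y_mem t a))]
    rw [this]
    exact ((ih.mono (pastSigma_mono t.le_succ) le_rfl).add
      (hG.measurable.comp (measurable_y_past x y st t))).max measurable_const

theorem measurable_dist_past (hp : p.Standing Mf Mg) (hr : p.IsRun V W0 Z0 P st x y W Z)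
    (c : MultVec I J) (t : ℕ) :
    Measurable[pastSigma (fun t a => (st t a, x t a, y t a)) t]
      fun a => ‖multVec (W t a) (Z t a) - c‖ :=
  measurable_norm_multVec_sub (hr.measurable_W_past hp t) (hr.measurable_Z_past t) c

/-- Deterministic initial queues and bounded increments give a deterministic bound in each slot. It
depends on t and serves only for integrability. -/
theorem exists_dist_le (hp : p.Standing Mf Mg) (hr : p.IsRun V W0 Z0 P st x y W Z)
    (c : MultVec I J) (t : ℕ) : ∃ N, ∀ a, ‖multVec (W t a) (Z t a) - c‖ ≤ N := by
  induction t with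
  | zero => exact ⟨‖multVec W0 Z0 - c‖, fun a => by rw [hr.W_zero, hr.Z_zero]⟩
  | succ t ih =>
    obtain ⟨N, hN⟩ := ih
    refine ⟨N + √(2 * p.driftConst), fun a => ?_⟩
    have := (abs_le.1 (hr.norm_succ_sub_le hp t a c)).2
    linarith [hN a]

theorem exists_Z_le (hp : p.Standing Mf Mg) (hr : p.IsRun V W0 Z0 P st x y W Z) (t : ℕ) :
    ∃ N, ∀ a, ‖Z t a‖ ≤ N := by
  obtain ⟨N, hN⟩ := hr.exists_dist_le hp 0 t
  refine ⟨N, fun a => ?_⟩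
  have := norm_sub_le_norm_multVec_sub (W t a) (Z t a) 0
  have e2 : (0 : MultVec I J).snd = 0 := rfl
  rw [e2, sub_zero] at this
  exact this.trans (hN a)

theorem integrable_comp_dist (hp : p.Standing Mf Mg) (hr : p.IsRun V W0 Z0 P st x y W Z)
    (ν : Measure Ω') [IsProbabilityMeasure ν] (c : MultVec I J) (t : ℕ) {ψ : ℝ → ℝ}
    (hψ : Measurable ψ) (hb : ∀ N, ∃ b, ∀ k, 0 ≤ k → k ≤ N → |ψ k| ≤ b) :
    Integrable (fun a => ψ ‖multVec (W t a) (Z t a) - c‖) ν := by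
  obtain ⟨N, hN⟩ := hr.exists_dist_le hp c t
  obtain ⟨b, hb⟩ := hb N
  exact Integrable.of_bound
    (hψ.comp ((hr.measurable_dist_past hp c t).mono (hr.past_le t) le_rfl)).aestronglyMeasurable
    b (ae_of_all _ fun a => hb _ (norm_nonneg _) (hN a))

theorem integrable_comp_dist_of_continuous (hp : p.Standing Mf Mg)
    (hr : p.IsRun V W0 Z0 P st x y W Z)
    (ν : Measure Ω') [IsProbabilityMeasure ν] (c : MultVec I J) (t : ℕ) {ψ : ℝ → ℝ}
    (hψ : Continuous ψ) :
    Integrable (fun a => ψ ‖multVec (W t a) (Z t a) - c‖) ν := by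
  refine hr.integrable_comp_dist hp ν c t hψ.measurable fun N => ?_
  obtain ⟨b, hb⟩ := (isCompact_Icc (a := 0) (b := N)).exists_bound_of_continuousOn
    hψ.continuousOn
  exact ⟨b, fun k h0 hk => hb k ⟨h0, hk⟩⟩

end Measurability

section Tail

variable {ν : Measure Ω'} [IsProbabilityMeasure ν] {s : ℕ}

theorem integral_minDev_eq_zero (hp : p.Standing Mf Mg) (hr : p.IsRun V W0 Z0 P st x y W Z)
    (hν : IsTailStateProcess p.prob ν st (fun t a => (st t a, x t a, y t a)) s)
    {t : ℕ} (ht : s ≤ t) :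
    Integrable (fun a => p.minDev (st t a) (V⁻¹ • Z t a)) ν ∧
      ∫ a, p.minDev (st t a) (V⁻¹ • Z t a) ∂ν = 0 := by
  obtain ⟨N, hN⟩ := hr.exists_Z_le hp t
  have hZb : ∀ a, ‖V⁻¹ • Z t a‖ ≤ ‖V⁻¹‖ * N := fun a => by
    rw [norm_smul]; exact mul_le_mul_of_nonneg_left (hN a) (norm_nonneg _)
  have hZm := (hr.measurable_Z_past t).const_smul V⁻¹
  have h1 := hp.integrable_mul_minDev (ν := ν) (hr.states.measurable t)
    (measurable_const (a := (1 : ℝ))) (hZm.mono (hr.past_le t) le_rfl) (fun _ => le_rfl) hZb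
  have h2 := hp.integral_mul_minDev (hr.states.measurable t) (hν.law t ht) (hr.past_le t)
    (hν.indep t ht) (measurable_const (a := (1 : ℝ))) hZm (fun _ => le_rfl) hZb
  simp only [one_mul] at h1 h2
  exact ⟨h1, h2⟩

/-- The weight is a function of the queues, hence of the past. In the Lyapunov argument it is the
factor of the noise in a first-order expansion. -/
theorem integral_noise_eq_zero (hp : p.Standing Mf Mg) (hr : p.IsRun V W0 Z0 P st x y W Z)
    (hν : IsTailStateProcess p.prob ν st (fun t a => (st t a, x t a, y t a)) s)
    {t : ℕ} (ht : s ≤ t) (c l : MultVec I J) {ψ : ℝ → ℝ}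
    (hψ : Measurable ψ) (hb : ∀ N, ∃ b, ∀ k, 0 ≤ k → k ≤ N → |ψ k| ≤ b) :
    Integrable (fun a => ψ ‖multVec (W t a) (Z t a) - c‖
      * (V * (p.minDev (st t a) (V⁻¹ • Z t a) - p.minDev (st t a) l.snd))) ν ∧
    ∫ a, ψ ‖multVec (W t a) (Z t a) - c‖
      * (V * (p.minDev (st t a) (V⁻¹ • Z t a) - p.minDev (st t a) l.snd)) ∂ν = 0 := by
  obtain ⟨N, hN⟩ := hr.exists_Z_le hp t
  obtain ⟨K, hK⟩ := hr.exists_dist_le hp c t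
  obtain ⟨b, hb⟩ := hb K
  have hφb : ∀ a, |ψ ‖multVec (W t a) (Z t a) - c‖| ≤ b := fun a =>
    hb _ (norm_nonneg _) (hK a)
  have hφm := hψ.comp (hr.measurable_dist_past hp c t)
  have hZb : ∀ a, ‖V⁻¹ • Z t a‖ ≤ ‖V⁻¹‖ * N := fun a => by
    rw [norm_smul]; exact mul_le_mul_of_nonneg_left (hN a) (norm_nonneg _)
  have hZm := (hr.measurable_Z_past t).const_smul V⁻¹
  have hσ := hr.states.measurable t
  have hle := hr.past_le t
  have h1 := hp.integrable_mul_minDev (ν := ν) hσ (hφm.mono hle le_rfl)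
    (hZm.mono hle le_rfl) hφb hZb
  have h1' := hp.integral_mul_minDev hσ (hν.law t ht) hle (hν.indep t ht) hφm hZm hφb hZb
  have h2 := hp.integrable_mul_minDev (ν := ν) hσ (hφm.mono hle le_rfl)
    (measurable_const (a := l.snd)) hφb (fun _ => le_rfl)
  have h2' := hp.integral_mul_minDev hσ (hν.law t ht) hle (hν.indep t ht) hφm
    (measurable_const (a := l.snd)) hφb (fun _ => le_rfl)
  have e : ∀ a, ψ ‖multVec (W t a) (Z t a) - c‖
      * (V * (p.minDev (st t a) (V⁻¹ • Z t a) - p.minDev (st t a) l.snd))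
      = V * (ψ ‖multVec (W t a) (Z t a) - c‖ * p.minDev (st t a) (V⁻¹ • Z t a)
        - ψ ‖multVec (W t a) (Z t a) - c‖ * p.minDev (st t a) l.snd) := fun a => by ring
  simp only [e]
  refine ⟨(h1.sub h2).const_mul V, ?_⟩
  have h3 := integral_sub h1 h2
  rw [h1', h2', sub_zero] at h3
  rw [integral_const_mul]
  exact mul_eq_zero_of_right _ h3

end Tail

end IsRun

end TAProblem

/-! ### Deterministic drift estimates for exp(rk). -/

section Constants

variable {C L V : ℝ}

theorem bG_pos (hV : 0 < V) : 0 < bG C L V :=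
  lt_of_lt_of_le (by positivity) (le_max_left _ _)

theorem rG_pos (hC : 0 < C) : 0 < rG C V := by
  unfold rG; positivity

theorem rhoG_eq (hC : 0 < C) (hV : 0 < V) : rhoG C V = 1 - rG C V / (2 * √V) := by
  have hs : 0 < √V := Real.sqrt_pos.2 hV
  have h1 : √(2 * C * V) = √(2 * C) * √V := Real.sqrt_mul (by positivity) V
  have h2 : 12 * C * V + 2 * √(2 * C * V) = (6 * C * √V + √(2 * C)) * (2 * √V) := by
    rw [h1]
    linear_combination (-12 * C) * Real.mul_self_sqrt hV.le
  rw [rhoG, rG, h2, div_div]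

theorem rhoG_lt_one (hC : 0 < C) (hV : 0 < V) : rhoG C V < 1 := by
  rw [rhoG_eq hC hV]
  have := rG_pos (V := V) hC
  have : 0 < rG C V / (2 * √V) := by positivity
  linarith

theorem rG_mul_lt (hC : 0 < C) (hV : 0 < V) : rG C V * √(2 * C) < 3 := by
  have hs : 0 < √V := Real.sqrt_pos.2 hV
  have : 0 < √(2 * C) := by positivity
  have : 0 < 6 * C * √V := by positivity
  rw [rG, div_mul_eq_mul_div, div_lt_iff₀ (by positivity)]
  linarith

/-- This equation is what determines r: the second-order term of Bernstein's bound equals half of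
the linear drift r/√V. -/
theorem rG_bernstein (hC : 0 < C) (hV : 0 < V) :
    (rG C V * √(2 * C)) ^ 2 / (2 * (1 - rG C V * √(2 * C) / 3)) = rG C V / (2 * √V) := by
  have hs : 0 < √V := Real.sqrt_pos.2 hV
  have hd : 0 < √(2 * C) := by positivity
  have hdd : √(2 * C) ^ 2 = 2 * C := Real.sq_sqrt (by positivity)
  have h1 : 1 - rG C V * √(2 * C) / 3 ≠ 0 := by linarith [rG_mul_lt hC hV]
  have h2 : rG C V * (6 * C * √V + √(2 * C)) = 3 := by
    rw [rG]; field_simp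
  rw [div_eq_div_iff (by positivity) (by positivity)]
  rw [mul_pow, hdd]
  linear_combination (2 * rG C V / 3) * h2

/-- One-slot drift of the exponential function outside the ball of radius `B_G(V)`. -/
theorem exp_drift_le {k k' N : ℝ} (hC : 0 < C) (hV : 0 < V) (hk : 0 < k)
    (hd : |k' - k| ≤ √(2 * C)) (h : k' ^ 2 ≤ k ^ 2 - 2 * k / √V + 2 * N) :
    Real.exp (rG C V * k') ≤ rhoG C V * Real.exp (rG C V * k)
      + rG C V * Real.exp (rG C V * k) / k * N := by
  have hr := rG_pos (V := V) hC
  have hs : 0 < √V := Real.sqrt_pos.2 hV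
  -- From 2k(k' − k) ≤ k'² − k².
  have h1 : k' - k ≤ -(1 / √V) + N / k := by
    have : (k' - k) * k ≤ (-(1 / √V) + N / k) * k := by
      have e : (-(1 / √V) + N / k) * k = -(2 * k / √V) / 2 + N := by field_simp
      rw [e]
      nlinarith [sq_nonneg (k' - k)]
    exact le_of_mul_le_mul_right this hk
  have h2 := Real.exp_le_bernstein (x := rG C V * (k' - k)) (c := rG C V * √(2 * C))
    (by rw [abs_mul, abs_of_pos hr]; gcongr) (rG_mul_lt hC hV)
  rw [rG_bernstein hC hV] at h2
  have h3 := mul_le_mul_of_nonneg_left h1 hr.le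
  have e : Real.exp (rG C V * k') = Real.exp (rG C V * k) * Real.exp (rG C V * (k' - k)) := by
    rw [← Real.exp_add]; ring_nf
  rw [e, rhoG_eq hC hV]
  have h4 : Real.exp (rG C V * (k' - k))
      ≤ 1 - rG C V / (2 * √V) + rG C V / k * N := by
    refine h2.trans ?_
    have e1 : rG C V * (-(1 / √V) + N / k) = -2 * (rG C V / (2 * √V)) + rG C V / k * N := by
      field_simp
    linarith
  refine (mul_le_mul_of_nonneg_left h4 (Real.exp_pos _).le).trans_eq ?_
  ring

/-- Worst case inside the ball: the increment is bounded by √(2C) without using the mean-zero noise.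
This crude step is what costs a logarithm in U_G. -/
theorem exp_step_le {k k' : ℝ} (hC : 0 < C) (hV : 0 < V) (hk : k < bG C L V)
    (hd : |k' - k| ≤ √(2 * C)) :
    Real.exp (rG C V * k') ≤ rhoG C V * Real.exp (rG C V * k)
      + (Real.exp (rG C V * √(2 * C)) - rhoG C V) * Real.exp (rG C V * bG C L V) := by
  have hr := rG_pos (V := V) hC
  have h1 : Real.exp (rG C V * k') ≤ Real.exp (rG C V * √(2 * C)) * Real.exp (rG C V * k) := by
    rw [← Real.exp_add, ← mul_add]
    refine Real.exp_le_exp.2 (mul_le_mul_of_nonneg_left ?_ hr.le)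
    linarith [(abs_le.1 hd).2]
  have h2 : 0 ≤ Real.exp (rG C V * √(2 * C)) - rhoG C V := by
    have : 1 ≤ Real.exp (rG C V * √(2 * C)) := Real.one_le_exp (by positivity)
    linarith [rhoG_lt_one hC hV]
  have h3 : Real.exp (rG C V * k) ≤ Real.exp (rG C V * bG C L V) := by gcongr
  nlinarith

/-! ### The smoothed Lyapunov function exp(η√(k² + V)/√V). -/

variable (C L)

/-- The ratio of `B_G(V)` to `√V` for large `V`. -/
def ballSlope : ℝ := (1 + √(1 + 4 * L * C)) / (2 * L)

/-- A lower bound on `k / √(k² + V)` outside the ball of radius `B_G(V)`. -/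
def driftSlope : ℝ := ballSlope C L / √(ballSlope C L ^ 2 + 1)

/-- The exponent of the smoothed Lyapunov function is `smoothRate / √V`. -/
def smoothRate : ℝ := driftSlope C L / (4 * C)

/-- The smoothed Lyapunov function contracts by the factor `1 - smoothGap / V`. -/
def smoothGap : ℝ := driftSlope C L ^ 2 / (8 * C)

/-- A bound on the smoothed Lyapunov function in the ball of radius `B_G(V)`. -/
def smoothBall : ℝ := Real.exp (smoothRate C L * √(max 1 (ballSlope C L) ^ 2 + 1))

/-- The one-slot growth of the smoothed Lyapunov function in the ball, times `V`. -/
def smoothGrowth : ℝ :=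
  smoothBall C L * (smoothRate C L * C + 2 * C * smoothRate C L ^ 2 + smoothGap C L)

/-- A bound on the mean of the smoothed Lyapunov function. -/
def smoothMoment : ℝ := smoothGrowth C L / smoothGap C L + smoothBall C L

/-- The smoothed Lyapunov function is used for `V` above this threshold. -/
def smoothThreshold : ℝ := 1 + 2 * C * smoothRate C L ^ 2

open Classical in
/-- First-moment bound of order `√V`. -/
def uSmooth (V : ℝ) : ℝ :=
  if smoothThreshold C L ≤ V then Real.log (smoothMoment C L) / (smoothRate C L / √V)
  else uG C L V

open Classical in
/-- Second-moment bound of order `V`. -/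
def uSmooth' (V : ℝ) : ℝ :=
  if smoothThreshold C L ≤ V then 2 * smoothMoment C L / (smoothRate C L / √V) ^ 2
  else uG' C L V

variable {C L}

theorem ballSlope_pos (hL : 0 < L) : 0 < ballSlope C L := by unfold ballSlope; positivity

theorem driftSlope_pos (hL : 0 < L) : 0 < driftSlope C L := by
  have := ballSlope_pos (C := C) hL
  unfold driftSlope; positivity

theorem smoothRate_pos (hC : 0 < C) (hL : 0 < L) : 0 < smoothRate C L := by
  have := driftSlope_pos (C := C) hL
  unfold smoothRate; positivity

theorem smoothGap_pos (hC : 0 < C) (hL : 0 < L) : 0 < smoothGap C L := by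
  have := driftSlope_pos (C := C) hL
  unfold smoothGap; positivity

theorem smoothGrowth_pos (hC : 0 < C) (hL : 0 < L) : 0 < smoothGrowth C L := by
  have := smoothRate_pos hC hL
  have := smoothGap_pos hC hL
  unfold smoothGrowth smoothBall; positivity

theorem smoothMoment_pos (hC : 0 < C) (hL : 0 < L) : 0 < smoothMoment C L := by
  have := smoothGrowth_pos hC hL
  have := smoothGap_pos hC hL
  unfold smoothMoment smoothBall; positivity

/-- With δ the drift slope, the rate η = δ/(4C) maximizes ηδ − 2Cη², the net contraction after the
second-order term of the exponential. -/
theorem smoothGap_eq (hC : 0 < C) :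
    smoothRate C L * driftSlope C L - 2 * C * smoothRate C L ^ 2 = smoothGap C L := by
  unfold smoothRate smoothGap
  field_simp
  ring

theorem one_le_smoothThreshold (hC : 0 < C) : 1 ≤ smoothThreshold C L := by
  unfold smoothThreshold
  have : 0 ≤ 2 * C * smoothRate C L ^ 2 := by positivity
  linarith

/-- The smoothed distance is 1-Lipschitz in k, so it inherits the increment bound √(2C). Multiply
the difference by the sum of the two roots and use k ≤ √(k² + V). -/
theorem abs_sqrt_sub_sqrt_le {k k' : ℝ} (hV : 0 < V) (hk : 0 ≤ k) (hk' : 0 ≤ k') :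
    |√(k' ^ 2 + V) - √(k ^ 2 + V)| ≤ |k' - k| := by
  have h1 : k ≤ √(k ^ 2 + V) := Real.le_sqrt_of_sq_le (by linarith)
  have h2 : k' ≤ √(k' ^ 2 + V) := Real.le_sqrt_of_sq_le (by linarith)
  have h3 : 0 < √(k ^ 2 + V) := Real.sqrt_pos.2 (by positivity)
  have h4 : 0 < √(k' ^ 2 + V) := Real.sqrt_pos.2 (by positivity)
  have e1 : √(k ^ 2 + V) ^ 2 = k ^ 2 + V := Real.sq_sqrt (by positivity)
  have e2 : √(k' ^ 2 + V) ^ 2 = k' ^ 2 + V := Real.sq_sqrt (by positivity)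
  have e : |√(k' ^ 2 + V) - √(k ^ 2 + V)| * (√(k' ^ 2 + V) + √(k ^ 2 + V))
      = |k' - k| * (k' + k) := by
    have e3 := congrArg abs (show (√(k' ^ 2 + V) - √(k ^ 2 + V)) * (√(k' ^ 2 + V) + √(k ^ 2 + V))
      = (k' - k) * (k' + k) by linear_combination e2 - e1)
    rwa [abs_mul, abs_mul, abs_of_pos (add_pos h4 h3), abs_of_nonneg (add_nonneg hk' hk)] at e3
  have h5 : |k' - k| * (k' + k) ≤ |k' - k| * (√(k' ^ 2 + V) + √(k ^ 2 + V)) :=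
    mul_le_mul_of_nonneg_left (by linarith) (abs_nonneg _)
  rw [← e] at h5
  exact le_of_mul_le_mul_right h5 (add_pos h4 h3)

/-- One-slot growth of the smoothed exponential function. -/
theorem exp_sqrt_le {k k' q N : ℝ} (hC : 0 < C) (hL : 0 < L) (hV : smoothThreshold C L ≤ V)
    (hk : 0 ≤ k) (hk' : 0 ≤ k') (hd : |k' - k| ≤ √(2 * C))
    (h : k' ^ 2 ≤ k ^ 2 + 2 * q * √(k ^ 2 + V) / √V + 2 * N) :
    Real.exp (smoothRate C L / √V * √(k' ^ 2 + V))
      ≤ (1 + (smoothRate C L * q + 2 * C * smoothRate C L ^ 2) / V)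
          * Real.exp (smoothRate C L / √V * √(k ^ 2 + V))
        + smoothRate C L / √V * Real.exp (smoothRate C L / √V * √(k ^ 2 + V))
          / √(k ^ 2 + V) * N := by
  have hV1 : 1 ≤ V := (one_le_smoothThreshold hC).trans hV
  have hV0 : 0 < V := by linarith
  have hη := smoothRate_pos hC hL
  have hs : 0 < √V := Real.sqrt_pos.2 hV0
  have hss : √V ^ 2 = V := Real.sq_sqrt hV0.le
  have hΔ := (abs_sqrt_sub_sqrt_le hV0 hk hk').trans hd
  have h3 : 0 < √(k ^ 2 + V) := Real.sqrt_pos.2 (by positivity)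
  have e1 : √(k ^ 2 + V) ^ 2 = k ^ 2 + V := Real.sq_sqrt (by positivity)
  have e2 : √(k' ^ 2 + V) ^ 2 = k' ^ 2 + V := Real.sq_sqrt (by positivity)
  set g := √(k ^ 2 + V)
  set g' := √(k' ^ 2 + V)
  set η := smoothRate C L
  have hr : 0 < η / √V := by positivity
  have h4 : g' - g ≤ q / √V + N / g := by
    have : (g' - g) * g ≤ (q / √V + N / g) * g := by
      have e : (q / √V + N / g) * g = (2 * q * g / √V) / 2 + N := by field_simp
      rw [e]
      nlinarith [sq_nonneg (g' - g)]
    exact le_of_mul_le_mul_right this h3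
  -- The threshold on V is chosen for this, so that the quadratic bound on the exponential applies.
  have hc : η / √V * √(2 * C) ≤ 1 := by
    rw [div_mul_eq_mul_div, div_le_one hs]
    refine Real.le_sqrt_of_sq_le ?_
    rw [mul_pow, Real.sq_sqrt (by positivity)]
    unfold smoothThreshold at hV
    change 1 + 2 * C * η ^ 2 ≤ V at hV
    linarith
  have h5 := Real.exp_le_one_add_add_sq (x := η / √V * (g' - g)) (c := η / √V * √(2 * C))
    (by rw [abs_mul, abs_of_pos hr]; gcongr) hc
  have e3 : (η / √V * √(2 * C)) ^ 2 = 2 * C * η ^ 2 / V := by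
    rw [mul_pow, div_pow, hss, Real.sq_sqrt (by positivity)]
    ring
  have h6 := mul_le_mul_of_nonneg_left h4 hr.le
  have e4 : η / √V * (q / √V + N / g) = η * q / V + η / √V / g * N := by
    rw [mul_add, div_mul_div_comm, ← sq, hss]; ring
  have e : Real.exp (η / √V * g') = Real.exp (η / √V * g) * Real.exp (η / √V * (g' - g)) := by
    rw [← Real.exp_add]; ring_nf
  rw [e]
  have h7 : Real.exp (η / √V * (g' - g))
      ≤ 1 + (η * q + 2 * C * η ^ 2) / V + η / √V / g * N := by
    rw [add_div]
    linarith
  refine (mul_le_mul_of_nonneg_left h7 (Real.exp_pos _).le).trans_eq ?_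
  ring

/-- For k ≥ β√V, with β the ball slope, the ratio k/√(k² + V) is at least δ, since it increases with
k. The inward drift of k therefore survives smoothing up to the factor δ. -/
theorem exp_sqrt_drift_le {k k' N : ℝ} (hC : 0 < C) (hL : 0 < L) (hV : smoothThreshold C L ≤ V)
    (hk : bG C L V ≤ k) (hk' : 0 ≤ k') (hd : |k' - k| ≤ √(2 * C))
    (h : k' ^ 2 ≤ k ^ 2 - 2 * k / √V + 2 * N) :
    Real.exp (smoothRate C L / √V * √(k' ^ 2 + V))
      ≤ (1 - smoothGap C L / V) * Real.exp (smoothRate C L / √V * √(k ^ 2 + V))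
        + smoothRate C L / √V * Real.exp (smoothRate C L / √V * √(k ^ 2 + V))
          / √(k ^ 2 + V) * N := by
  have hV1 : 1 ≤ V := (one_le_smoothThreshold hC).trans hV
  have hV0 : 0 < V := by linarith
  have hs : 0 < √V := Real.sqrt_pos.2 hV0
  have hss : √V ^ 2 = V := Real.sq_sqrt hV0.le
  have hb := ballSlope_pos (C := C) hL
  have hk0 : 0 < k := (bG_pos hV0).trans_le hk
  have hkb : √V * ballSlope C L ≤ k := (le_max_right _ _).trans hk
  have h1 : driftSlope C L * √(k ^ 2 + V) ≤ k := by
    rw [driftSlope, div_mul_eq_mul_div, div_le_iff₀ (by positivity)]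
    refine (pow_le_pow_iff_left₀ (by positivity) (by positivity) two_ne_zero).1 ?_
    rw [mul_pow, mul_pow, Real.sq_sqrt (by positivity), Real.sq_sqrt (by positivity)]
    have := pow_le_pow_left₀ (by positivity) hkb 2
    rw [mul_pow, hss] at this
    nlinarith
  have h2 := exp_sqrt_le (q := -driftSlope C L) (N := N) hC hL hV hk0.le hk' hd (by
    refine h.trans ?_
    have : driftSlope C L * √(k ^ 2 + V) / √V ≤ k / √V := by gcongr
    have e1 : 2 * -driftSlope C L * √(k ^ 2 + V) / √V
      = -2 * (driftSlope C L * √(k ^ 2 + V) / √V) := by ring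
    have e2 : 2 * k / √V = 2 * (k / √V) := by ring
    rw [e1, e2]
    linarith)
  have e : 1 + (smoothRate C L * -driftSlope C L + 2 * C * smoothRate C L ^ 2) / V
      = 1 - smoothGap C L / V := by
    rw [← smoothGap_eq hC]; ring
  rwa [e] at h2

theorem exp_sqrt_ball_le {k : ℝ} (hC : 0 < C) (hL : 0 < L) (hV : 1 ≤ V) (hk0 : 0 ≤ k)
    (hk : k < bG C L V) :
    Real.exp (smoothRate C L / √V * √(k ^ 2 + V)) ≤ smoothBall C L := by
  have hV0 : 0 < V := by linarith
  have hs : 0 < √V := Real.sqrt_pos.2 hV0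
  have hs1 : 1 ≤ √V := Real.one_le_sqrt.2 hV
  have hss : √V ^ 2 = V := Real.sq_sqrt hV0.le
  have hη := smoothRate_pos hC hL
  have hb := ballSlope_pos (C := C) hL
  have h1 : k ≤ √V * max 1 (ballSlope C L) := by
    refine hk.le.trans (max_le ?_ ?_)
    · calc 1 / √V ≤ 1 := by rw [div_le_one hs]; exact hs1
        _ ≤ √V * 1 := by linarith
        _ ≤ _ := by gcongr; exact le_max_left _ _
    · change √V * ballSlope C L ≤ _
      gcongr
      exact le_max_right _ _
  have h2 : √(k ^ 2 + V) ≤ √V * √(max 1 (ballSlope C L) ^ 2 + 1) := by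
    rw [← Real.sqrt_mul hV0.le]
    refine Real.sqrt_le_sqrt ?_
    have := pow_le_pow_left₀ hk0 h1 2
    rw [mul_pow, hss] at this
    linarith
  refine Real.exp_le_exp.2 ?_
  calc smoothRate C L / √V * √(k ^ 2 + V)
      ≤ smoothRate C L / √V * (√V * √(max 1 (ballSlope C L) ^ 2 + 1)) := by gcongr
    _ = _ := by field_simp

/-- Since √(k² + V) ≥ √V, the term C moves the smoothed distance by at most C/√V, apart from the
noise that is kept for averaging. Multiplied by η/√V this is of order 1/V, the order of the
contraction. -/
theorem exp_sqrt_step_le {k k' N : ℝ} (hC : 0 < C) (hL : 0 < L) (hV : smoothThreshold C L ≤ V)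
    (hk0 : 0 ≤ k) (hk : k < bG C L V) (hk' : 0 ≤ k') (hd : |k' - k| ≤ √(2 * C))
    (h : k' ^ 2 ≤ k ^ 2 + 2 * C + 2 * N) :
    Real.exp (smoothRate C L / √V * √(k' ^ 2 + V))
      ≤ (1 - smoothGap C L / V) * Real.exp (smoothRate C L / √V * √(k ^ 2 + V))
        + smoothRate C L / √V * Real.exp (smoothRate C L / √V * √(k ^ 2 + V))
          / √(k ^ 2 + V) * N + smoothGrowth C L / V := by
  have hV1 : 1 ≤ V := (one_le_smoothThreshold hC).trans hV
  have hV0 : 0 < V := by linarith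
  have hs : 0 < √V := Real.sqrt_pos.2 hV0
  have h2 := exp_sqrt_le (q := C) (N := N) hC hL hV hk0 hk' hd (by
    refine h.trans ?_
    have : 1 ≤ √(k ^ 2 + V) / √V := by
      rw [one_le_div hs]; exact Real.sqrt_le_sqrt (by nlinarith)
    have e : 2 * C * √(k ^ 2 + V) / √V = 2 * C * (√(k ^ 2 + V) / √V) := by ring
    rw [e]
    nlinarith)
  have h3 := exp_sqrt_ball_le hC hL hV1 hk0 hk
  have hη := smoothRate_pos hC hL
  have hg := smoothGap_pos hC hL
  have h4 := mul_le_mul_of_nonneg_right h3 (show 0 ≤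
    (smoothRate C L * C + 2 * C * smoothRate C L ^ 2 + smoothGap C L) / V by positivity)
  have e : smoothBall C L * ((smoothRate C L * C + 2 * C * smoothRate C L ^ 2
      + smoothGap C L) / V) = smoothGrowth C L / V := by
    rw [smoothGrowth, mul_div_assoc]
  rw [e] at h4
  refine h2.trans ?_
  have e2 : ∀ A : ℝ, (1 + (smoothRate C L * C + 2 * C * smoothRate C L ^ 2) / V) * A
      = (1 - smoothGap C L / V) * A + A * ((smoothRate C L * C + 2 * C * smoothRate C L ^ 2
      + smoothGap C L) / V) := fun A => by ring
  rw [e2]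
  linarith

theorem uSmooth_isBigO (C L : ℝ) : (fun V => uSmooth C L V) =O[atTop] fun V => √V := by
  refine IsBigO.of_bound |Real.log (smoothMoment C L) / smoothRate C L| ?_
  filter_upwards [eventually_ge_atTop (smoothThreshold C L)] with V hV
  rw [uSmooth, if_pos hV, div_div_eq_mul_div, mul_div_right_comm, norm_mul]
  rfl

theorem uSmooth'_isBigO (C L : ℝ) : (fun V => uSmooth' C L V) =O[atTop] fun V => V := by
  refine IsBigO.of_bound |2 * smoothMoment C L / smoothRate C L ^ 2| ?_
  filter_upwards [eventually_ge_atTop (smoothThreshold C L), eventually_ge_atTop 0] with V hV h0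
  rw [uSmooth', if_pos hV, div_pow, Real.sq_sqrt h0, div_div_eq_mul_div, mul_div_right_comm,
    norm_mul]
  rfl

end Constants

/-! ### Geometric drift and uniform moment bounds. -/

namespace TAProblem

namespace IsRun

variable {Ω : Type u} {I J : ℕ} {p : TAProblem Ω I J} {Mf : ℝ} {Mg : Fin J → ℝ}
variable [MeasurableSpace Ω] [Countable Ω] [MeasurableSingletonClass Ω]
variable {Ω' : Type*} [m : MeasurableSpace Ω'] {P : Measure Ω'} {V : ℝ}
  {W0 : EuclideanSpace ℝ (Fin J)} {Z0 : EuclideanSpace ℝ (Fin I)}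
  {st : ℕ → Ω' → Ω} {x y : ℕ → Ω' → EuclideanSpace ℝ (Fin I)}
  {W : ℕ → Ω' → EuclideanSpace ℝ (Fin J)} {Z : ℕ → Ω' → EuclideanSpace ℝ (Fin I)}
  {ν : Measure Ω'} [IsProbabilityMeasure ν] {s : ℕ}

/-- Geometric drift: a Lyapunov function `ψ` of the distance to `c` that contracts in conditional
mean outside the ball of radius `B`, and grows by at most `b` inside, has bounded mean. -/
theorem integral_lyapunov_le (hp : p.Standing Mf Mg) (hr : p.IsRun V W0 Z0 P st x y W Z)
    (hν : IsTailStateProcess p.prob ν st (fun t a => (st t a, x t a, y t a)) s)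
    (c l : MultVec I J) {ψ φ : ℝ → ℝ} {ρ b M B : ℝ} (hψ : Continuous ψ) (hψ0 : ∀ k, 0 ≤ ψ k)
    (hφ : Measurable φ) (hφb : ∀ N, ∃ b, ∀ k, 0 ≤ k → k ≤ N → |φ k| ≤ b)
    (hρ : ρ < 1) (hb : 0 ≤ b) (hM0 : 0 ≤ M) (hM : ∀ k, 0 ≤ k → k < B → ψ k ≤ M)
    (hout : ∀ t a, B ≤ ‖multVec (W t a) (Z t a) - c‖ →
      ψ ‖multVec (W (t + 1) a) (Z (t + 1) a) - c‖ ≤ ρ * ψ ‖multVec (W t a) (Z t a) - c‖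
        + φ ‖multVec (W t a) (Z t a) - c‖
          * (V * (p.minDev (st t a) (V⁻¹ • Z t a) - p.minDev (st t a) l.snd)))
    (hin : ∀ t a, ‖multVec (W t a) (Z t a) - c‖ < B →
      ψ ‖multVec (W (t + 1) a) (Z (t + 1) a) - c‖ ≤ ρ * ψ ‖multVec (W t a) (Z t a) - c‖
        + φ ‖multVec (W t a) (Z t a) - c‖
          * (V * (p.minDev (st t a) (V⁻¹ • Z t a) - p.minDev (st t a) l.snd)) + b)
    (hstart : ∀ᵐ a ∂ν, ‖multVec (W s a) (Z s a) - c‖ < B) {t : ℕ} (ht : s ≤ t) :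
    ∫ a, ψ ‖multVec (W t a) (Z t a) - c‖ ∂ν ≤ b / (1 - ρ) + M := by
  have hi : ∀ t, Integrable (fun a => ψ ‖multVec (W t a) (Z t a) - c‖) ν := fun t =>
    hr.integrable_comp_dist_of_continuous hp ν c t hψ
  have hbd : 0 ≤ b / (1 - ρ) := div_nonneg hb (by linarith)
  -- For ρ ≥ 0 the affine recursion is iterated by induction. For small V the factor ρ may be
  -- negative, and multiplying the induction hypothesis by it would reverse the inequality.
  rcases le_or_gt 0 ρ with hρ0 | hρ0
  · induction t, ht using Nat.le_induction with
    | base =>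
      have : ∫ a, ψ ‖multVec (W s a) (Z s a) - c‖ ∂ν ≤ ∫ _, M ∂ν := by
        refine integral_mono_ae (hi s) (integrable_const _) ?_
        filter_upwards [hstart] with a ha
        exact hM _ (norm_nonneg _) ha
      simp only [integral_const, probReal_univ, one_smul] at this
      linarith
    | succ t ht ih =>
      obtain ⟨h1, h2⟩ := hr.integral_noise_eq_zero (V := V) hp hν ht c l hφ hφb
      have h3 := integral_mono (hi (t + 1)) ((((hi t).const_mul ρ).add h1).add
        (integrable_const b)) fun a => ?_
      · rw [integral_add' (((hi t).const_mul ρ).add h1) (integrable_const b),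
          integral_add' ((hi t).const_mul ρ) h1, h2, integral_const_mul] at h3
        simp only [integral_const, probReal_univ, one_smul, add_zero] at h3
        refine h3.trans ?_
        have h4 := mul_le_mul_of_nonneg_left ih hρ0
        have h5 : ρ * (b / (1 - ρ) + M) + b = b / (1 - ρ) + ρ * M := by
          have : 1 - ρ ≠ 0 := by linarith
          field_simp
          ring
        nlinarith
      · simp only [Pi.add_apply]
        rcases lt_or_ge ‖multVec (W t a) (Z t a) - c‖ B with h | h
        · exact hin t a h
        · linarith [hout t a h]
  -- With ρ < 0, integrate 0 ≤ ψ(k') ≤ ρψ(k) + noise over the outside of the ball only. The noise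
  -- vanishes in mean, so the mean of ψ outside is at most 0, and the bound M inside suffices.
  · have hmI : MeasurableSet {k : ℝ | B ≤ k} := measurableSet_Ici
    obtain ⟨h1, h2⟩ := hr.integral_noise_eq_zero (V := V) hp hν ht c l
      (ψ := {k | B ≤ k}.indicator φ) (hφ.indicator hmI) fun N => by
        obtain ⟨b, hb⟩ := hφb N
        refine ⟨b, fun k h0 hk => ?_⟩
        rw [← Real.norm_eq_abs]
        exact (norm_indicator_le_norm_self φ k).trans (hb k h0 hk)
    have h3 : Integrable (fun a => {k | B ≤ k}.indicator ψ ‖multVec (W t a) (Z t a) - c‖) ν :=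
      hr.integrable_comp_dist hp ν c t (hψ.measurable.indicator hmI) fun N => by
        obtain ⟨b, hb⟩ := (isCompact_Icc (a := 0) (b := N)).exists_bound_of_continuousOn
          hψ.continuousOn
        refine ⟨b, fun k h0 hk => ?_⟩
        rw [← Real.norm_eq_abs]
        exact (norm_indicator_le_norm_self ψ k).trans (hb k ⟨h0, hk⟩)
    have h4 : 0 ≤ ∫ a, (ρ * {k | B ≤ k}.indicator ψ ‖multVec (W t a) (Z t a) - c‖
        + {k | B ≤ k}.indicator φ ‖multVec (W t a) (Z t a) - c‖
          * (V * (p.minDev (st t a) (V⁻¹ • Z t a) - p.minDev (st t a) l.snd))) ∂ν := by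
      refine integral_nonneg fun a => ?_
      by_cases h : B ≤ ‖multVec (W t a) (Z t a) - c‖
      · simp only [Set.indicator_of_mem (show _ ∈ {k : ℝ | B ≤ k} from h)]
        exact (hψ0 _).trans (hout t a h)
      · simp only [Set.indicator_of_notMem (show _ ∉ {k : ℝ | B ≤ k} from h)]
        simp
    rw [integral_add (h3.const_mul ρ) h1, h2, integral_const_mul, add_zero] at h4
    have h5 : ∫ a, {k | B ≤ k}.indicator ψ ‖multVec (W t a) (Z t a) - c‖ ∂ν ≤ 0 := by
      by_contra! h
      nlinarith
    have h6 := integral_mono (hi t) ((integrable_const M).add h3) fun a => ?_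
    · rw [integral_add' (integrable_const M) h3] at h6
      simp only [integral_const, probReal_univ, one_smul] at h6
      linarith
    · simp only [Pi.add_apply]
      by_cases h : B ≤ ‖multVec (W t a) (Z t a) - c‖
      · simp only [Set.indicator_of_mem (show _ ∈ {k : ℝ | B ≤ k} from h)]
        linarith
      · simp only [Set.indicator_of_notMem (show _ ∉ {k : ℝ | B ≤ k} from h), add_zero]
        exact hM _ (norm_nonneg _) (not_le.1 h)

end IsRun

end TAProblem

/-- An exponential moment bounds the first two moments. -/
theorem moments_le_of_exp {Ω' : Type*} [MeasurableSpace Ω'] {ν : Measure Ω'}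
    [IsProbabilityMeasure ν] {k h : Ω' → ℝ} {r M : ℝ} (hr : 0 < r) (hM : 0 < M)
    (hk0 : ∀ a, 0 ≤ k a) (hkh : ∀ a, k a ≤ h a) (hk : Integrable k ν)
    (hk2 : Integrable (fun a => k a ^ 2) ν) (he : Integrable (fun a => Real.exp (r * h a)) ν)
    (hle : ∫ a, Real.exp (r * h a) ∂ν ≤ M) :
    ∫ a, k a ∂ν ≤ Real.log M / r ∧ ∫ a, k a ^ 2 ∂ν ≤ 2 * M / r ^ 2 := by
  have hexp : ∀ a, Real.exp (r * k a) ≤ Real.exp (r * h a) := fun a =>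
    Real.exp_le_exp.2 (mul_le_mul_of_nonneg_left (hkh a) hr.le)
  constructor
  · have h0 : Integrable (fun a => r * k a + (1 - Real.log M)) ν :=
      (hk.const_mul r).add (integrable_const _)
    -- Jensen's inequality through the tangent line of exp at log M.
    have h1 : ∫ a, M * (r * k a + (1 - Real.log M)) ∂ν ≤ ∫ a, Real.exp (r * h a) ∂ν := by
      refine integral_mono (h0.const_mul M) he fun a => le_trans ?_ (hexp a)
      have h2 := Real.add_one_le_exp (r * k a - Real.log M)
      have h3 : Real.exp (r * k a) = M * Real.exp (r * k a - Real.log M) := by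
        rw [Real.exp_sub, Real.exp_log hM]; field_simp
      rw [h3]
      exact mul_le_mul_of_nonneg_left (by linarith) hM.le
    rw [integral_const_mul, integral_add (hk.const_mul r) (integrable_const _),
      integral_const_mul] at h1
    simp only [integral_const, probReal_univ, one_smul] at h1
    have h4 : M * (r * ∫ a, k a ∂ν + (1 - Real.log M)) ≤ M * 1 := by linarith
    have h5 := le_of_mul_le_mul_left h4 hM
    rw [le_div_iff₀ hr]
    linarith
  · have h1 : ∫ a, r ^ 2 / 2 * k a ^ 2 ∂ν ≤ ∫ a, Real.exp (r * h a) ∂ν := by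
      refine integral_mono (hk2.const_mul _) he fun a => le_trans ?_ (hexp a)
      have := Real.quadratic_le_exp_of_nonneg (mul_nonneg hr.le (hk0 a))
      have := mul_nonneg hr.le (hk0 a)
      show r ^ 2 / 2 * k a ^ 2 ≤ _
      nlinarith
    rw [integral_const_mul] at h1
    rw [le_div_iff₀ (by positivity)]
    linarith

namespace TAProblem

namespace IsRun

variable {Ω : Type u} {I J : ℕ} {p : TAProblem Ω I J} {Mf : ℝ} {Mg : Fin J → ℝ}
variable [MeasurableSpace Ω] [Countable Ω] [MeasurableSingletonClass Ω]
variable {Ω' : Type*} [m : MeasurableSpace Ω'] {P : Measure Ω'} {V : ℝ}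
  {W0 : EuclideanSpace ℝ (Fin J)} {Z0 : EuclideanSpace ℝ (Fin I)}
  {st : ℕ → Ω' → Ω} {x y : ℕ → Ω' → EuclideanSpace ℝ (Fin I)}
  {W : ℕ → Ω' → EuclideanSpace ℝ (Fin J)} {Z : ℕ → Ω' → EuclideanSpace ℝ (Fin I)}
  {ν : Measure Ω'} [IsProbabilityMeasure ν] {s : ℕ} {l : MultVec I J} {S L L' : ℝ}

/-- By maximality of l the dual gap is never positive and can be dropped. -/
theorem sq_drift_ball_le (hp : p.Standing Mf Mg) (hr : p.IsRun V W0 Z0 P st x y W Z)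
    (hV : 0 < V) (hl : p.IsUniqueMultiplier l) (t : ℕ) (a : Ω') :
    ‖multVec (W (t + 1) a) (Z (t + 1) a) - V • l‖ ^ 2
      ≤ ‖multVec (W t a) (Z t a) - V • l‖ ^ 2 + 2 * p.driftConst
        + 2 * (V * (p.minDev (st t a) (V⁻¹ • Z t a) - p.minDev (st t a) l.snd)) := by
  have h1 := hr.sq_drift_le hp hV hl.1 t a
  have h2 := hl.2.1 _ (hr.dualFeasible_scaled hV t a)
  nlinarith

theorem sq_drift_outside_le (hp : p.Standing Mf Mg) (hr : p.IsRun V W0 Z0 P st x y W Z)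
    (hV : 0 < V) (hC : 0 < p.driftConst) (hl : p.IsUniqueMultiplier l)
    (hlnp : p.LocallyNonPolyhedral l S L L') (hB' : bG' p.driftConst L' ≤ S * V)
    (hsV : 2 / L' ≤ √V) (t : ℕ) (a : Ω')
    (hk : bG p.driftConst L V ≤ ‖multVec (W t a) (Z t a) - V • l‖) :
    ‖multVec (W (t + 1) a) (Z (t + 1) a) - V • l‖ ^ 2
      ≤ ‖multVec (W t a) (Z t a) - V • l‖ ^ 2 - 2 * ‖multVec (W t a) (Z t a) - V • l‖ / √V
        + 2 * (V * (p.minDev (st t a) (V⁻¹ • Z t a) - p.minDev (st t a) l.snd)) := by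
  have h1 := hr.sq_drift_le hp hV hl.1 t a
  have e : V * ‖V⁻¹ • multVec (W t a) (Z t a) - l‖ = ‖multVec (W t a) (Z t a) - V • l‖ := by
    rw [dist_scaled hV]; field_simp
  have h2 := dual_gap_ge hC hlnp (hr.dualFeasible_scaled hV t a) hV hB' hsV (by rwa [e])
  rw [e] at h2
  linarith

theorem moments_le_uG (hp : p.Standing Mf Mg) (hr : p.IsRun V W0 Z0 P st x y W Z)
    (hV : 0 < V) (hC : 0 < p.driftConst) (hl : p.IsUniqueMultiplier l)
    (hlnp : p.LocallyNonPolyhedral l S L L') (hB' : bG' p.driftConst L' ≤ S * V)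
    (hsV : 2 / L' ≤ √V)
    (hν : IsTailStateProcess p.prob ν st (fun t a => (st t a, x t a, y t a)) s)
    (hstart : ∀ᵐ a ∂ν, ‖multVec (W s a) (Z s a) - V • l‖ < bG p.driftConst L V)
    {t : ℕ} (ht : s ≤ t) :
    ∫ a, ‖multVec (W t a) (Z t a) - V • l‖ ∂ν ≤ uG p.driftConst L V ∧
      ∫ a, ‖multVec (W t a) (Z t a) - V • l‖ ^ 2 ∂ν ≤ uG' p.driftConst L V := by
  set C := p.driftConst
  have hr0 := rG_pos (V := V) hC
  have hB := bG_pos (C := C) (L := L) hV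
  have hρ := rhoG_lt_one hC hV
  have h1 : 1 ≤ Real.exp (rG C V * √(2 * C)) := Real.one_le_exp (by positivity)
  have hb : 0 ≤ (Real.exp (rG C V * √(2 * C)) - rhoG C V) * Real.exp (rG C V * bG C L V) :=
    mul_nonneg (by linarith) (Real.exp_pos _).le
  -- The noise weight is cut off inside the ball: r exp(rk)/k is unbounded near k = 0, and the
  -- worst-case step there carries no noise.
  have hmain := hr.integral_lyapunov_le hp hν (V • l) l (ψ := fun k => Real.exp (rG C V * k))
    (φ := {k | bG C L V ≤ k}.indicator fun k => rG C V * Real.exp (rG C V * k) / k)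
    (by fun_prop) (fun k => (Real.exp_pos _).le)
    (Measurable.indicator (by fun_prop) measurableSet_Ici) (fun N => ?_) hρ hb
    (Real.exp_pos (rG C V * bG C L V)).le
    (fun k _ hk => by gcongr) (fun t a hk => ?_) (fun t a hk => ?_) hstart ht
  · refine moments_le_of_exp (h := fun a => ‖multVec (W t a) (Z t a) - V • l‖) hr0 ?_
      (fun a => norm_nonneg _) (fun a => le_rfl)
      (hr.integrable_comp_dist_of_continuous hp ν _ t continuous_id)
      (hr.integrable_comp_dist_of_continuous hp ν _ t (continuous_id.pow 2))
      (hr.integrable_comp_dist_of_continuous hp ν _ t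
        (ψ := fun k => Real.exp (rG C V * k)) (by fun_prop)) (hmain.trans_eq ?_)
    · have : 0 ≤ dG C L V := by
        unfold dG
        exact div_nonneg (mul_nonneg (Real.exp_pos _).le (by linarith)) (by linarith)
      positivity
    · rw [dG, mul_comm (Real.exp (rG C V * bG C L V))]
  · refine ⟨rG C V * Real.exp (rG C V * N) / bG C L V, fun k h0 hk => ?_⟩
    by_cases h : bG C L V ≤ k
    · rw [Set.indicator_of_mem (show _ ∈ {k : ℝ | bG C L V ≤ k} from h), abs_of_nonneg
        (by positivity)]
      gcongr
    · rw [Set.indicator_of_notMem (show _ ∉ {k : ℝ | bG C L V ≤ k} from h), abs_zero]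
      positivity
  · rw [Set.indicator_of_mem (show _ ∈ {k : ℝ | bG C L V ≤ k} from hk)]
    exact exp_drift_le hC hV (hB.trans_le hk) (hr.norm_succ_sub_le hp t a _)
      (hr.sq_drift_outside_le hp hV hC hl hlnp hB' hsV t a hk)
  · rw [Set.indicator_of_notMem (show _ ∉ {k : ℝ | bG C L V ≤ k} from not_le.2 hk), zero_mul,
      add_zero]
    exact exp_step_le hC hV hk (hr.norm_succ_sub_le hp t a _)

theorem moments_le_uSmooth (hp : p.Standing Mf Mg) (hr : p.IsRun V W0 Z0 P st x y W Z)
    (hV : 0 < V) (hC : 0 < p.driftConst) (hl : p.IsUniqueMultiplier l)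
    (hlnp : p.LocallyNonPolyhedral l S L L') (hB' : bG' p.driftConst L' ≤ S * V)
    (hsV : 2 / L' ≤ √V)
    (hν : IsTailStateProcess p.prob ν st (fun t a => (st t a, x t a, y t a)) s)
    (hstart : ∀ᵐ a ∂ν, ‖multVec (W s a) (Z s a) - V • l‖ < bG p.driftConst L V)
    {t : ℕ} (ht : s ≤ t) :
    ∫ a, ‖multVec (W t a) (Z t a) - V • l‖ ∂ν ≤ uSmooth p.driftConst L V ∧
      ∫ a, ‖multVec (W t a) (Z t a) - V • l‖ ^ 2 ∂ν ≤ uSmooth' p.driftConst L V := by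
  by_cases hth : smoothThreshold p.driftConst L ≤ V
  swap
  · rw [uSmooth, uSmooth', if_neg hth, if_neg hth]
    exact hr.moments_le_uG hp hV hC hl hlnp hB' hsV hν hstart ht
  rw [uSmooth, uSmooth', if_pos hth, if_pos hth]
  set C := p.driftConst
  have hL := hlnp.2.1
  have hη := smoothRate_pos hC hL
  have hg := smoothGap_pos hC hL
  have hG := smoothGrowth_pos hC hL
  have hs : 0 < √V := Real.sqrt_pos.2 hV
  have hsq : ∀ k : ℝ, √(k ^ 2 + V) ≠ 0 := fun k => (Real.sqrt_pos.2 (by positivity)).ne'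
  have hφ : Continuous fun k : ℝ => smoothRate C L / √V
      * Real.exp (smoothRate C L / √V * √(k ^ 2 + V)) / √(k ^ 2 + V) :=
    Continuous.div (by fun_prop) (by fun_prop) hsq
  -- Here the weight is continuous because √(k² + V) > 0, so the noise is kept inside the ball as
  -- well.
  have hmain := hr.integral_lyapunov_le hp hν (V • l) l
    (ψ := fun k => Real.exp (smoothRate C L / √V * √(k ^ 2 + V)))
    (φ := fun k => smoothRate C L / √V
      * Real.exp (smoothRate C L / √V * √(k ^ 2 + V)) / √(k ^ 2 + V))
    (ρ := 1 - smoothGap C L / V) (b := smoothGrowth C L / V) (M := smoothBall C L)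
    (B := bG C L V)
    (by fun_prop) (fun k => (Real.exp_pos _).le) hφ.measurable (fun N => ?_)
    (by have : 0 < smoothGap C L / V := by positivity
        linarith) (by positivity) (Real.exp_pos _).le
    (fun k h0 hk => exp_sqrt_ball_le hC hL ((one_le_smoothThreshold hC).trans hth) h0 hk)
    (fun t a hk => ?_) (fun t a hk => ?_) hstart ht
  · refine moments_le_of_exp (h := fun a => √(‖multVec (W t a) (Z t a) - V • l‖ ^ 2 + V))
      (by positivity) (smoothMoment_pos hC hL)
      (fun a => norm_nonneg _) (fun a => Real.le_sqrt_of_sq_le (by linarith))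
      (hr.integrable_comp_dist_of_continuous hp ν _ t continuous_id)
      (hr.integrable_comp_dist_of_continuous hp ν _ t (continuous_id.pow 2))
      (hr.integrable_comp_dist_of_continuous hp ν _ t
        (ψ := fun k => Real.exp (smoothRate C L / √V * √(k ^ 2 + V))) (by fun_prop))
      (hmain.trans_eq ?_)
    rw [sub_sub_cancel, smoothMoment]
    congr 1
    field_simp
  · obtain ⟨b, hb⟩ := (isCompact_Icc (a := 0) (b := N)).exists_bound_of_continuousOn
      hφ.continuousOn
    exact ⟨b, fun k h0 hk => hb k ⟨h0, hk⟩⟩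
  · exact exp_sqrt_drift_le hC hL hth hk (norm_nonneg _) (hr.norm_succ_sub_le hp t a _)
      (hr.sq_drift_outside_le hp hV hC hl hlnp hB' hsV t a hk)
  · exact exp_sqrt_step_le hC hL hth (norm_nonneg _) hk (norm_nonneg _)
      (hr.norm_succ_sub_le hp t a _) (hr.sq_drift_ball_le hp hV hl t a)

end IsRun

end TAProblem

/-! ### From queue moments to time averages. -/

theorem slotAvg_mem {I : ℕ} {Ω' : Type*} {x : ℕ → Ω' → EuclideanSpace ℝ (Fin I)}
    {A : Set (EuclideanSpace ℝ (Fin I))} (hA : Convex ℝ A) (hx : ∀ t a, x t a ∈ A) (t₀ : ℕ)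
    {T : ℕ} (hT : 0 < T) (a : Ω') : slotAvg x t₀ T a ∈ A := by
  rw [slotAvg, Finset.smul_sum]
  refine hA.sum_mem (fun _ _ => by positivity) ?_ fun t _ => hx t a
  have : (T : ℝ) ≠ 0 := by positivity
  simp [this]

theorem ConvexOn.map_slotAvg_le {I : ℕ} {Ω' : Type*}
    {x : ℕ → Ω' → EuclideanSpace ℝ (Fin I)} {A : Set (EuclideanSpace ℝ (Fin I))}
    {φ : EuclideanSpace ℝ (Fin I) → ℝ} (hφ : ConvexOn ℝ A φ) (hx : ∀ t a, x t a ∈ A) (t₀ : ℕ)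
    {T : ℕ} (hT : 0 < T) (a : Ω') :
    φ (slotAvg x t₀ T a) ≤ (T : ℝ)⁻¹ * ∑ t ∈ Finset.Ico t₀ (t₀ + T), φ (x t a) := by
  rw [slotAvg, Finset.smul_sum, Finset.mul_sum]
  refine hφ.map_sum_le (fun _ _ => by positivity) ?_ fun t _ => hx t a
  have : (T : ℝ) ≠ 0 := by positivity
  simp [this]

theorem measurable_slotAvg {I : ℕ} {Ω' : Type*} [MeasurableSpace Ω']
    {x : ℕ → Ω' → EuclideanSpace ℝ (Fin I)} (hx : ∀ t, Measurable (x t)) (t₀ T : ℕ) :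
    Measurable (slotAvg x t₀ T) := by
  unfold slotAvg
  have h : Measurable fun a => ∑ t ∈ Finset.Ico t₀ (t₀ + T), x t a :=
    Finset.measurable_sum _ fun t _ => hx t
  exact h.const_smul (T : ℝ)⁻¹

namespace TAProblem

namespace IsRun

variable {Ω : Type u} {I J : ℕ} {p : TAProblem Ω I J} {Mf : ℝ} {Mg : Fin J → ℝ}
variable [MeasurableSpace Ω]
variable {Ω' : Type*} [m : MeasurableSpace Ω'] {P : Measure Ω'} {V : ℝ}
  {W0 : EuclideanSpace ℝ (Fin J)} {Z0 : EuclideanSpace ℝ (Fin I)}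
  {st : ℕ → Ω' → Ω} {x y : ℕ → Ω' → EuclideanSpace ℝ (Fin I)}
  {W : ℕ → Ω' → EuclideanSpace ℝ (Fin J)} {Z : ℕ → Ω' → EuclideanSpace ℝ (Fin I)}

theorem slotAvg_x_mem (hr : p.IsRun V W0 Z0 P st x y W Z) (t₀ : ℕ) {T : ℕ} (hT : 0 < T)
    (a : Ω') : slotAvg x t₀ T a ∈ p.Y ∪ convexHull ℝ (⋃ o, p.X o) :=
  Or.inr (slotAvg_mem (convex_convexHull ℝ _) (fun t a => subset_convexHull ℝ _
    (Set.mem_iUnion.2 ⟨_, hr.x_mem t a⟩)) t₀ hT a)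

theorem slotAvg_y_mem (hp : p.Standing Mf Mg) (hr : p.IsRun V W0 Z0 P st x y W Z) (t₀ : ℕ)
    {T : ℕ} (hT : 0 < T) (a : Ω') :
    slotAvg y t₀ T a ∈ p.Y ∪ convexHull ℝ (⋃ o, p.X o) :=
  Or.inl (slotAvg_mem hp.Y_convex hr.y_mem t₀ hT a)

theorem sum_sub_eq (hr : p.IsRun V W0 Z0 P st x y W Z) (t₀ T : ℕ) (a : Ω') :
    ∑ t ∈ Finset.Ico t₀ (t₀ + T), (x t a - y t a) = Z (t₀ + T) a - Z t₀ a := by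
  induction T with
  | zero => simp
  | succ T ih =>
    rw [← Nat.add_assoc, Finset.sum_Ico_succ_top (Nat.le_add_right _ _), ih, hr.Z_succ]
    abel

theorem sum_g_le (hr : p.IsRun V W0 Z0 P st x y W Z) (t₀ T : ℕ) (a : Ω') (j : Fin J) :
    ∑ t ∈ Finset.Ico t₀ (t₀ + T), p.g j (y t a) ≤ W (t₀ + T) a j - W t₀ a j := by
  induction T with
  | zero => simp
  | succ T ih =>
    rw [← Nat.add_assoc, Finset.sum_Ico_succ_top (Nat.le_add_right _ _), hr.W_succ]
    linarith [le_max_left (W (t₀ + T) a j + p.g j (y (t₀ + T) a)) 0]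

/-- The average decision is close to the average auxiliary vector. -/
theorem norm_slotAvg_sub_le (hr : p.IsRun V W0 Z0 P st x y W Z) (t₀ T : ℕ) (a : Ω')
    (c : MultVec I J) :
    ‖slotAvg x t₀ T a - slotAvg y t₀ T a‖ ≤ (T : ℝ)⁻¹
      * (‖multVec (W t₀ a) (Z t₀ a) - c‖ + ‖multVec (W (t₀ + T) a) (Z (t₀ + T) a) - c‖) := by
  rw [slotAvg, slotAvg, ← smul_sub, ← Finset.sum_sub_distrib, hr.sum_sub_eq, norm_smul,
    norm_inv, Real.norm_natCast]
  refine mul_le_mul_of_nonneg_left ?_ (by positivity)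
  have h1 := norm_sub_le_norm_multVec_sub (W t₀ a) (Z t₀ a) c
  have h2 := norm_sub_le_norm_multVec_sub (W (t₀ + T) a) (Z (t₀ + T) a) c
  have h3 := norm_sub_le (Z (t₀ + T) a - c.snd) (Z t₀ a - c.snd)
  rw [sub_sub_sub_cancel_right] at h3
  linarith

/-- The summand 1 comes from Jensen's inequality and the telescoped queue W at the average of y, the
summand `Mg j` from passing to the average of x. Both end terms are measured from c, which is V λ*
in the application. -/
theorem g_slotAvg_le (hp : p.Standing Mf Mg) (hr : p.IsRun V W0 Z0 P st x y W Z) (t₀ : ℕ)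
    {T : ℕ} (hT : 0 < T) (a : Ω') (c : MultVec I J) (j : Fin J) :
    p.g j (slotAvg x t₀ T a) ≤ (T : ℝ)⁻¹ * (1 + Mg j)
      * (‖multVec (W t₀ a) (Z t₀ a) - c‖ + ‖multVec (W (t₀ + T) a) (Z (t₀ + T) a) - c‖) := by
  have hT' : 0 ≤ (T : ℝ)⁻¹ := by positivity
  have h1 := (abs_le.1 (hp.g_lip j _ (hr.slotAvg_x_mem t₀ hT a) _
    (hr.slotAvg_y_mem hp t₀ hT a))).2
  have h2 := (hp.g_convex_Y j).map_slotAvg_le hr.y_mem t₀ hT a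
  have h3 := mul_le_mul_of_nonneg_left (hr.sum_g_le t₀ T a j) hT'
  have h4 := mul_le_mul_of_nonneg_left (hr.norm_slotAvg_sub_le t₀ T a c) (hp.Mg_pos j).le
  have h5 := abs_le.1 (abs_sub_le_norm_multVec_sub (W t₀ a) (Z t₀ a) c j)
  have h6 := abs_le.1 (abs_sub_le_norm_multVec_sub (W (t₀ + T) a) (Z (t₀ + T) a) c j)
  have h7 : (T : ℝ)⁻¹ * (W (t₀ + T) a j - W t₀ a j) ≤ (T : ℝ)⁻¹
      * (‖multVec (W t₀ a) (Z t₀ a) - c‖ + ‖multVec (W (t₀ + T) a) (Z (t₀ + T) a) - c‖) :=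
    mul_le_mul_of_nonneg_left (by linarith) hT'
  linarith

/-- Expand both squares about V l and drop −‖q' − V l‖². Only the cross terms see ‖l‖, so ‖V l‖²
itself cancels. -/
theorem norm_sq_sub_norm_sq_le (q q' l : MultVec I J) (hV : 0 < V) :
    ‖q‖ ^ 2 - ‖q'‖ ^ 2 ≤ ‖q - V • l‖ ^ 2
      + 2 * V * ‖l‖ * (‖q - V • l‖ + ‖q' - V • l‖) := by
  have h1 := norm_add_sq_real (q - V • l) (V • l)
  have h2 := norm_add_sq_real (q' - V • l) (V • l)
  rw [sub_add_cancel] at h1 h2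
  have h3 := real_inner_le_norm (q - V • l) (V • l)
  have h4 := (abs_le.1 (abs_real_inner_le_norm (q' - V • l) (V • l))).1
  rw [norm_smul, Real.norm_of_nonneg hV.le] at h3 h4
  nlinarith [sq_nonneg ‖q' - V • l‖]

variable [Countable Ω] [MeasurableSingletonClass Ω]

theorem sum_objective_le (hp : p.Standing Mf Mg) (hr : p.IsRun V W0 Z0 P st x y W Z)
    (hV : 0 < V) (t₀ T : ℕ) (a : Ω') :
    V * ∑ t ∈ Finset.Ico t₀ (t₀ + T), p.f (y t a) ≤ T * (V * p.fopt + p.driftConst)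
      + (‖multVec (W t₀ a) (Z t₀ a)‖ ^ 2
        - ‖multVec (W (t₀ + T) a) (Z (t₀ + T) a)‖ ^ 2) / 2
      + V * ∑ t ∈ Finset.Ico t₀ (t₀ + T), p.minDev (st t a) (V⁻¹ • Z t a) := by
  induction T with
  | zero => simp
  | succ T ih =>
    rw [← Nat.add_assoc, Finset.sum_Ico_succ_top (Nat.le_add_right _ _),
      Finset.sum_Ico_succ_top (Nat.le_add_right _ _)]
    have := hr.objective_le hp hV (t₀ + T) a
    push_cast
    linarith

theorem f_slotAvg_le (hp : p.Standing Mf Mg) (hr : p.IsRun V W0 Z0 P st x y W Z)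
    (hV : 0 < V) (t₀ : ℕ) {T : ℕ} (hT : 0 < T) (a : Ω') (l : MultVec I J) :
    p.f (slotAvg x t₀ T a) ≤ p.fopt + p.driftConst / V
      + (2 * T * V)⁻¹ * ‖multVec (W t₀ a) (Z t₀ a) - V • l‖ ^ 2
      + (‖l‖ + Mf) / T * (‖multVec (W t₀ a) (Z t₀ a) - V • l‖
        + ‖multVec (W (t₀ + T) a) (Z (t₀ + T) a) - V • l‖)
      + (T : ℝ)⁻¹ * ∑ t ∈ Finset.Ico t₀ (t₀ + T), p.minDev (st t a) (V⁻¹ • Z t a) := by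
  have hT' : (0 : ℝ) < T := by positivity
  have h1 := (abs_le.1 (hp.f_lip _ (hr.slotAvg_x_mem t₀ hT a) _
    (hr.slotAvg_y_mem hp t₀ hT a))).2
  have h2 := hp.f_convex_Y.map_slotAvg_le hr.y_mem t₀ hT a
  have h4 := mul_le_mul_of_nonneg_left (hr.norm_slotAvg_sub_le t₀ T a (V • l)) hp.Mf_pos.le
  have h3 := hr.sum_objective_le hp hV t₀ T a
  have h5 := norm_sq_sub_norm_sq_le (multVec (W t₀ a) (Z t₀ a))
    (multVec (W (t₀ + T) a) (Z (t₀ + T) a)) l hV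
  set k := ‖multVec (W t₀ a) (Z t₀ a) - V • l‖
  set k' := ‖multVec (W (t₀ + T) a) (Z (t₀ + T) a) - V • l‖
  set D := ∑ t ∈ Finset.Ico t₀ (t₀ + T), p.minDev (st t a) (V⁻¹ • Z t a)
  have h6 : V * ∑ t ∈ Finset.Ico t₀ (t₀ + T), p.f (y t a) ≤ T * (V * p.fopt + p.driftConst)
      + (k ^ 2 + 2 * V * ‖l‖ * (k + k')) / 2 + V * D := by linarith
  have h7 := mul_le_mul_of_nonneg_left h6 (show 0 ≤ (T : ℝ)⁻¹ * V⁻¹ by positivity)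
  have e1 : (T : ℝ)⁻¹ * V⁻¹ * (V * ∑ t ∈ Finset.Ico t₀ (t₀ + T), p.f (y t a))
      = (T : ℝ)⁻¹ * ∑ t ∈ Finset.Ico t₀ (t₀ + T), p.f (y t a) := by field_simp
  have e2 : (T : ℝ)⁻¹ * V⁻¹ * (T * (V * p.fopt + p.driftConst)
      + (k ^ 2 + 2 * V * ‖l‖ * (k + k')) / 2 + V * D)
      = p.fopt + p.driftConst / V + (2 * T * V)⁻¹ * k ^ 2 + ‖l‖ / T * (k + k')
        + (T : ℝ)⁻¹ * D := by
    field_simp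
    ring
  have e3 : (‖l‖ + Mf) / T * (k + k') = ‖l‖ / T * (k + k') + Mf * ((T : ℝ)⁻¹ * (k + k')) := by
    field_simp
  rw [e1, e2] at h7
  rw [e3]
  linarith

omit [Countable Ω] [MeasurableSingletonClass Ω] in
theorem integrable_f_slotAvg (hp : p.Standing Mf Mg) (hr : p.IsRun V W0 Z0 P st x y W Z)
    (ν : Measure Ω') [IsFiniteMeasure ν] (t₀ : ℕ) {T : ℕ} (hT : 0 < T) :
    Integrable (fun a => p.f (slotAvg x t₀ T a)) ν := by
  obtain ⟨b, hb⟩ := hp.exists_bound_f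
  obtain ⟨F, hF, hFe⟩ := hp.exists_extension_f
  refine Integrable.of_bound (Measurable.aestronglyMeasurable ?_) b
    (ae_of_all _ fun a => hb _ (hr.slotAvg_x_mem t₀ hT a))
  have : (fun a => p.f (slotAvg x t₀ T a)) = fun a => F (slotAvg x t₀ T a) :=
    funext fun a => hFe (hr.slotAvg_x_mem t₀ hT a)
  rw [this]
  exact hF.measurable.comp (measurable_slotAvg hr.measurable_x t₀ T)

omit [Countable Ω] [MeasurableSingletonClass Ω] in
theorem integrable_g_slotAvg (hp : p.Standing Mf Mg) (hr : p.IsRun V W0 Z0 P st x y W Z)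
    (ν : Measure Ω') [IsFiniteMeasure ν] (t₀ : ℕ) {T : ℕ} (hT : 0 < T) (j : Fin J) :
    Integrable (fun a => p.g j (slotAvg x t₀ T a)) ν := by
  obtain ⟨b, hb⟩ := hp.exists_bound_g j
  obtain ⟨F, hF, hFe⟩ := hp.exists_extension_g j
  refine Integrable.of_bound (Measurable.aestronglyMeasurable ?_) b
    (ae_of_all _ fun a => hb _ (hr.slotAvg_x_mem t₀ hT a))
  have : (fun a => p.g j (slotAvg x t₀ T a)) = fun a => F (slotAvg x t₀ T a) :=
    funext fun a => hFe (hr.slotAvg_x_mem t₀ hT a)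
  rw [this]
  exact hF.measurable.comp (measurable_slotAvg hr.measurable_x t₀ T)

/-- The bounds on the averages, given bounds on the moments of the distance to `V l`. -/
theorem formBound_of_moments (hp : p.Standing Mf Mg) (hr : p.IsRun V W0 Z0 P st x y W Z)
    (hV : 0 < V) {ν : Measure Ω'} [IsProbabilityMeasure ν] {s t₀ T : ℕ} (hst : s ≤ t₀)
    (hT : 0 < T) (l : MultVec I J) {U U' : ℝ}
    (hν : IsTailStateProcess p.prob ν st (fun t a => (st t a, x t a, y t a)) s)
    (hU : ∀ t, s ≤ t → ∫ a, ‖multVec (W t a) (Z t a) - V • l‖ ∂ν ≤ U)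
    (hU' : ∫ a, ‖multVec (W t₀ a) (Z t₀ a) - V • l‖ ^ 2 ∂ν ≤ U') :
    FormBound Mf Mg p.driftConst ‖l‖ V U U' T
      ((∫ a, p.f (slotAvg x t₀ T a) ∂ν) - p.fopt)
      (fun j => ∫ a, p.g j (slotAvg x t₀ T a) ∂ν) := by
  have hT' : (0 : ℝ) < T := by positivity
  have i1 := hr.integrable_comp_dist_of_continuous hp ν (V • l) t₀ continuous_id
  have i2 := hr.integrable_comp_dist_of_continuous hp ν (V • l) (t₀ + T) continuous_id
  have i3 := hr.integrable_comp_dist_of_continuous hp ν (V • l) t₀ (ψ := fun k => k ^ 2)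
    (by fun_prop)
  simp only [id_eq] at i1 i2
  have hU0 := hU t₀ hst
  have hU1 := hU (t₀ + T) (by omega)
  refine ⟨?_, fun j => ?_⟩
  · have hD : ∀ t ∈ Finset.Ico t₀ (t₀ + T),
        Integrable (fun a => p.minDev (st t a) (V⁻¹ • Z t a)) ν := fun t ht =>
      (hr.integral_minDev_eq_zero hp hν (hst.trans (Finset.mem_Ico.1 ht).1)).1
    have hD0 : ∫ a, ∑ t ∈ Finset.Ico t₀ (t₀ + T), p.minDev (st t a) (V⁻¹ • Z t a) ∂ν = 0 := by
      rw [integral_finsetSum _ hD]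
      exact Finset.sum_eq_zero fun t ht =>
        (hr.integral_minDev_eq_zero hp hν (hst.trans (Finset.mem_Ico.1 ht).1)).2
    have j1 : Integrable (fun _ : Ω' => p.fopt + p.driftConst / V) ν := integrable_const _
    have j2 := i3.const_mul (2 * T * V)⁻¹
    have j3 := (i1.add i2).const_mul ((‖l‖ + Mf) / T)
    have j4 := (integrable_finsetSum _ hD).const_mul (T : ℝ)⁻¹
    have h := integral_mono (hr.integrable_f_slotAvg hp ν t₀ hT) (((j1.add j2).add j3).add j4)
      fun a => hr.f_slotAvg_le hp hV t₀ hT a l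
    rw [integral_add' ((j1.add j2).add j3) j4, integral_add' (j1.add j2) j3,
      integral_add' j1 j2, integral_const_mul, integral_const_mul, integral_const_mul,
      integral_add' i1 i2, hD0] at h
    simp only [integral_const, probReal_univ, one_smul, mul_zero, add_zero] at h
    have h1 := mul_le_mul_of_nonneg_left hU' (show 0 ≤ (2 * (T : ℝ) * V)⁻¹ by positivity)
    have h2 := mul_le_mul_of_nonneg_left (add_le_add hU0 hU1) (show 0 ≤ (‖l‖ + Mf) / T from
      div_nonneg (add_nonneg (norm_nonneg _) hp.Mf_pos.le) hT'.le)
    -- Both ends of the window contribute a first moment, but only the start contributes a second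
    -- moment.
    have e : 2 * Mf * U / T + (U' + 4 * V * U * ‖l‖) / (2 * T * V) + p.driftConst / V
        = p.driftConst / V + (2 * T * V)⁻¹ * U' + (‖l‖ + Mf) / T * (U + U) := by
      field_simp
      ring
    rw [e]
    linarith
  · have j3 := (i1.add i2).const_mul ((T : ℝ)⁻¹ * (1 + Mg j))
    have h := integral_mono (hr.integrable_g_slotAvg hp ν t₀ hT j) j3
      fun a => hr.g_slotAvg_le hp t₀ hT a (V • l) j
    rw [integral_const_mul, integral_add' i1 i2] at h
    have h2 := mul_le_mul_of_nonneg_left (add_le_add hU0 hU1)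
      (show 0 ≤ (T : ℝ)⁻¹ * (1 + Mg j) by have := hp.Mg_pos j; positivity)
    have e : 2 * U / T + 2 * Mg j * U / T = (T : ℝ)⁻¹ * (1 + Mg j) * (U + U) := by
      field_simp
      ring
    change _ ≤ _
    rw [e]
    exact h.trans h2

end IsRun

end TAProblem

/-! ### Conditioning on the hitting time. -/

theorem transientTime_eq_iff {I J : ℕ} {Ω' : Type*} (l : MultVec I J) (V B : ℝ)
    (W : ℕ → Ω' → EuclideanSpace ℝ (Fin J)) (Z : ℕ → Ω' → EuclideanSpace ℝ (Fin I)) (a : Ω')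
    (s : ℕ) : transientTime l V B W Z a = (s : ℕ∞) ↔
      ‖multVec (W s a) (Z s a) - V • l‖ < B ∧
        ∀ i < s, ¬ ‖multVec (W i a) (Z i a) - V • l‖ < B := by
  unfold transientTime
  set A : Set ℕ := {t | ‖multVec (W t a) (Z t a) - V • l‖ < B}
  constructor
  · intro h
    have hne : ((fun t : ℕ => (t : ℕ∞)) '' A).Nonempty := by
      by_contra hne
      rw [Set.not_nonempty_iff_eq_empty.1 hne, sInf_empty] at h
      exact ENat.natCast_ne_top s h.symm
    obtain ⟨s', hs', he⟩ := csInf_mem hne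
    rw [h] at he
    obtain rfl : s' = s := Nat.cast_injective he
    refine ⟨hs', fun i hi hiA => ?_⟩
    have : ((s' : ℕ) : ℕ∞) ≤ (i : ℕ∞) := h ▸ sInf_le ⟨i, hiA, rfl⟩
    exact absurd (by exact_mod_cast this : s' ≤ i) (not_le.2 hi)
  · rintro ⟨h1, h2⟩
    refine le_antisymm (sInf_le ⟨s, h1, rfl⟩) (le_sInf ?_)
    rintro _ ⟨i, hi, rfl⟩
    by_contra! hlt
    exact h2 i (by exact_mod_cast hlt) hi

/-- A bound on conditional means over a finite partition is a bound on the mean. -/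
theorem integral_le_of_cond {Ω' : Type*} [MeasurableSpace Ω'] {P : Measure Ω'}
    [IsProbabilityMeasure P] {A : ℕ → Set Ω'} (hA : ∀ s, MeasurableSet (A s))
    (hd : Pairwise (Function.onFun Disjoint A)) (n : ℕ)
    (hcover : ∀ᵐ a ∂P, ∃ s ≤ n, a ∈ A s) {F : Ω' → ℝ} (hF : Integrable F P) {β : ℝ}
    (h : ∀ s ≤ n, P (A s) ≠ 0 → ∫ a, F a ∂P[|A s] ≤ β) : ∫ a, F a ∂P ≤ β := by
  have hU : P.restrict (⋃ s ∈ Finset.range (n + 1), A s) = P := by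
    refine Measure.restrict_eq_self_of_ae_mem ?_
    filter_upwards [hcover] with a ha
    obtain ⟨s, hs, ha⟩ := ha
    exact Set.mem_biUnion (by simpa using Nat.lt_succ_of_le hs) ha
  have h1 : ∀ G : Ω' → ℝ, Integrable G P →
      ∫ a, G a ∂P = ∑ s ∈ Finset.range (n + 1), ∫ a in A s, G a ∂P := fun G hG => by
    rw [← integral_biUnion_finset _ (fun s _ => hA s) (fun s _ t _ hst => hd hst)
      (fun s _ => hG.integrableOn), hU]
  have h2 : ∀ s ∈ Finset.range (n + 1), ∫ a in A s, F a ∂P ≤ ∫ _ in A s, β ∂P := by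
    intro s hs
    by_cases h0 : P (A s) = 0
    · rw [Measure.restrict_eq_zero.2 h0]; simp
    · have h3 := h s (Nat.lt_succ_iff.1 (Finset.mem_range.1 hs)) h0
      rw [ProbabilityTheory.cond, integral_smul_measure, ENNReal.toReal_inv, smul_eq_mul,
        inv_mul_le_iff₀ (ENNReal.toReal_pos h0 (measure_ne_top _ _))] at h3
      rw [setIntegral_const]
      exact h3
  calc ∫ a, F a ∂P ≤ ∫ _, β ∂P := by
        rw [h1 F hF, h1 _ (integrable_const β)]
        exact Finset.sum_le_sum h2
    _ = β := by simp

namespace TAProblem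

variable {Ω : Type u} {I J : ℕ} {p : TAProblem Ω I J} {Mf : ℝ} {Mg : Fin J → ℝ}
variable [MeasurableSpace Ω] {V : ℝ} {l : MultVec I J} {S L L' : ℝ}

theorem SteadyAverages.mono {Φ Ψ : ℕ → ℝ → (Fin J → ℝ) → Prop}
    (h : SteadyAverages.{u, v} p l L V Φ)
    (hΦ : ∀ T gap viol, 0 < T → Φ T gap viol → Ψ T gap viol) :
    SteadyAverages.{u, v} p l L V Ψ := by
  intro Ω' _ P _ W0 Z0 st x y W Z hr t₀ T hT
  obtain ⟨h1, h2⟩ := h Ω' P W0 Z0 st x y W Z hr t₀ T hT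
  exact ⟨fun ha => let ⟨a, b, c⟩ := h1 ha; ⟨a, b, hΦ _ _ _ hT c⟩,
    fun s hs h0 => let ⟨a, b, c⟩ := h2 s hs h0; ⟨a, b, hΦ _ _ _ hT c⟩⟩

variable [Countable Ω] [MeasurableSingletonClass Ω]

/-- Moment bounds after hitting the ball of radius `B_G(V)` give bounds on the averages. -/
theorem steadyAverages_of_moments (hp : p.Standing Mf Mg) (hV : 0 < V) {U U' : ℝ}
    (hU : ∀ (Ω' : Type v) [MeasurableSpace Ω'] (P ν : Measure Ω') [IsProbabilityMeasure ν]
      (W0 : EuclideanSpace ℝ (Fin J)) (Z0 : EuclideanSpace ℝ (Fin I))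
      (st : ℕ → Ω' → Ω) (x y : ℕ → Ω' → EuclideanSpace ℝ (Fin I))
      (W : ℕ → Ω' → EuclideanSpace ℝ (Fin J)) (Z : ℕ → Ω' → EuclideanSpace ℝ (Fin I))
      (s t : ℕ), p.IsRun V W0 Z0 P st x y W Z →
      IsTailStateProcess p.prob ν st (fun t a => (st t a, x t a, y t a)) s →
      (∀ᵐ a ∂ν, ‖multVec (W s a) (Z s a) - V • l‖ < bG p.driftConst L V) → s ≤ t →
      ∫ a, ‖multVec (W t a) (Z t a) - V • l‖ ∂ν ≤ U ∧
        ∫ a, ‖multVec (W t a) (Z t a) - V • l‖ ^ 2 ∂ν ≤ U') :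
    SteadyAverages.{u, v} p l L V (FormBound Mf Mg p.driftConst ‖l‖ V U U') := by
  intro Ω' _ P _ W0 Z0 st x y W Z hr t₀ T hT
  set B := bG p.driftConst L V
  let A : ℕ → Set Ω' := fun s => {a | transientTime l V B W Z a = (s : ℕ∞)}
  -- The queues of slots up to s depend only on slots before s, so the hitting event leaves the
  -- state of slot s fresh.
  have hA : ∀ s, MeasurableSet[pastSigma (fun t a => (st t a, x t a, y t a)) s] (A s) := by
    intro s
    have : A s = {a | ‖multVec (W s a) (Z s a) - V • l‖ < B} ∩
        ⋂ i ∈ Set.Iio s, {a | ‖multVec (W i a) (Z i a) - V • l‖ < B}ᶜ := by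
      ext a
      simp only [A, Set.mem_ofPred_eq, transientTime_eq_iff, Set.mem_inter_iff, Set.mem_iInter,
        Set.mem_compl_iff, Set.mem_Iio]
    rw [this]
    refine MeasurableSet.inter (hr.measurable_dist_past hp (V • l) s measurableSet_Iio)
      (MeasurableSet.biInter (Set.to_countable _) fun i hi => MeasurableSet.compl ?_)
    exact pastSigma_mono (le_of_lt hi) _
      (hr.measurable_dist_past hp (V • l) i measurableSet_Iio)
  have hA' : ∀ s, MeasurableSet (A s) := fun s => hr.past_le s _ (hA s)
  have hcond : ∀ s ≤ t₀, P (A s) ≠ 0 → FormBound Mf Mg p.driftConst ‖l‖ V U U' T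
      ((∫ a, p.f (slotAvg x t₀ T a) ∂P[|A s]) - p.fopt)
      (fun j => ∫ a, p.g j (slotAvg x t₀ T a) ∂P[|A s]) := by
    intro s hs h0
    have : IsProbabilityMeasure P[|A s] := cond_isProbabilityMeasure h0
    have hν := hr.states.cond hr.measurable_history (hA s) h0
    have hstart : ∀ᵐ a ∂P[|A s], ‖multVec (W s a) (Z s a) - V • l‖ < B := by
      filter_upwards [ae_cond_mem (μ := P) (hA' s)] with a ha
      exact ((transientTime_eq_iff l V B W Z a s).1 ha).1
    have hm := fun t => hU Ω' P P[|A s] W0 Z0 st x y W Z s t hr hν hstart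
    exact hr.formBound_of_moments hp hV hs hT l hν (fun t ht => (hm t ht).1) (hm t₀ hs).2
  refine ⟨fun has => ⟨hr.integrable_f_slotAvg hp P t₀ hT,
    hr.integrable_g_slotAvg hp P t₀ hT, ?_⟩, fun s hs h0 =>
      have : IsProbabilityMeasure P[|A s] := cond_isProbabilityMeasure h0
      ⟨hr.integrable_f_slotAvg hp _ t₀ hT, hr.integrable_g_slotAvg hp _ t₀ hT,
        hcond s hs h0⟩⟩
  have hd : Pairwise (Function.onFun Disjoint A) := fun s s' hne =>
    Set.disjoint_left.2 fun a ha ha' => hne (by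
      have : (s : ℕ∞) = (s' : ℕ∞) := ha.symm.trans ha'
      exact_mod_cast this)
  -- If the hitting time is at most t₀ almost surely, finitely many hitting events carry all the
  -- mass, and the unconditional bounds are averages of the conditional ones.
  have hcover : ∀ᵐ a ∂P, ∃ s ≤ t₀, a ∈ A s := by
    filter_upwards [has] with a ha
    obtain ⟨s, hs⟩ := ENat.ne_top_iff_exists.1 (ne_top_of_le_ne_top (ENat.natCast_ne_top t₀) ha)
    refine ⟨s, ?_, hs.symm⟩
    rw [← hs] at ha
    exact_mod_cast ha
  refine ⟨sub_le_iff_le_add.2 ?_, fun j => ?_⟩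
  · exact integral_le_of_cond hA' hd t₀ hcover (hr.integrable_f_slotAvg hp P t₀ hT)
      fun s hs h0 => sub_le_iff_le_add.1 (hcond s hs h0).1
  · exact integral_le_of_cond hA' hd t₀ hcover (hr.integrable_g_slotAvg hp P t₀ hT j)
      fun s hs h0 => (hcond s hs h0).2 j

theorem steadyAverages_uG (hp : p.Standing Mf Mg) (hC : 0 < p.driftConst)
    (hl : p.IsUniqueMultiplier l) (hlnp : p.LocallyNonPolyhedral l S L L') (hV : 0 < V)
    (hB' : bG' p.driftConst L' ≤ S * V) (hsV : 2 / L' ≤ √V) :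
    SteadyAverages.{u, v} p l L V (FormBound Mf Mg p.driftConst ‖l‖ V
      (uG p.driftConst L V) (uG' p.driftConst L V)) :=
  steadyAverages_of_moments hp hV fun _ _ _ _ _ _ _ _ _ _ _ _ _ _ hr hν hstart ht =>
    hr.moments_le_uG hp hV hC hl hlnp hB' hsV hν hstart ht

theorem steadyAverages_uSmooth (hp : p.Standing Mf Mg) (hC : 0 < p.driftConst)
    (hl : p.IsUniqueMultiplier l) (hlnp : p.LocallyNonPolyhedral l S L L') (hV : 0 < V)
    (hB' : bG' p.driftConst L' ≤ S * V) (hsV : 2 / L' ≤ √V) :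
    SteadyAverages.{u, v} p l L V (FormBound Mf Mg p.driftConst ‖l‖ V
      (uSmooth p.driftConst L V) (uSmooth' p.driftConst L V)) :=
  steadyAverages_of_moments hp hV fun _ _ _ _ _ _ _ _ _ _ _ _ _ _ hr hν hstart ht =>
    hr.moments_le_uSmooth hp hV hC hl hlnp hB' hsV hν hstart ht

end TAProblem

/-! ### Rates and convergence time. -/

theorem FormBound.rate {J : ℕ} {Mf : ℝ} {Mg : Fin J → ℝ} {C n V U U' k k' : ℝ} {T : ℕ}
    {gap : ℝ} {viol : Fin J → ℝ} (h : FormBound Mf Mg C n V U U' T gap viol) (hT : 0 < T)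
    (hV : 1 ≤ V) (hMf : 0 ≤ Mf) (hMg : ∀ j, 0 ≤ Mg j) (hn : 0 ≤ n) (hC : 0 ≤ C) (hk : 0 ≤ k)
    (hk' : 0 ≤ k') (hU : U ≤ k * √V) (hU' : U' ≤ k' * V) :
    gap ≤ (2 * Mf * k + k' / 2 + 2 * k * n + C + 2 * k * (1 + ∑ j, Mg j))
        * (√V / T + 1 / V) ∧
      ∀ j, viol j ≤ (2 * Mf * k + k' / 2 + 2 * k * n + C + 2 * k * (1 + ∑ j, Mg j))
        * (√V / T) := by
  have hV0 : 0 < V := by linarith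
  have hT0 : (0 : ℝ) < T := by positivity
  have hs : 1 ≤ √V := Real.one_le_sqrt.2 hV
  have hMs : 0 ≤ ∑ j, Mg j := Finset.sum_nonneg fun j _ => hMg j
  have hq : 0 ≤ √V / T := by positivity
  refine ⟨h.1.trans ?_, fun j => (h.2 j).trans ?_⟩
  · have h1 : 2 * Mf * U / T ≤ 2 * Mf * k * (√V / T) := by
      rw [← mul_div_assoc]
      gcongr ?_ / _
      rw [mul_assoc (2 * Mf)]
      gcongr
    have h2 : (U' + 4 * V * U * n) / (2 * T * V) ≤ (k' / 2 + 2 * k * n) * (√V / T) := by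
      rw [div_le_iff₀ (by positivity)]
      have e : (k' / 2 + 2 * k * n) * (√V / T) * (2 * T * V)
          = k' * V * √V + 4 * V * (k * √V) * n := by field_simp; ring
      rw [e]
      have h3 : 4 * V * U * n ≤ 4 * V * (k * √V) * n := by gcongr
      -- The second-moment term is only of order 1/T; since V ≥ 1 it is absorbed into √V/T.
      have h4 : k' * V ≤ k' * V * √V := le_mul_of_one_le_right (by positivity) hs
      linarith
    have h3 : 0 ≤ (C + 2 * k * (1 + ∑ j, Mg j)) * (√V / T) := by positivity
    have h4 : 0 ≤ (2 * Mf * k + k' / 2 + 2 * k * n + 2 * k * (1 + ∑ j, Mg j)) * (1 / V) := by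
      positivity
    have h5 : C / V = C * (1 / V) := by ring
    rw [h5]
    nlinarith
  · have h1 : Mg j ≤ ∑ j, Mg j := Finset.single_le_sum (fun j _ => hMg j) (Finset.mem_univ j)
    have h2 : 2 * U / T + 2 * Mg j * U / T ≤ 2 * k * (1 + ∑ j, Mg j) * (√V / T) := by
      have e1 : 2 * U / T + 2 * Mg j * U / T = 2 * (1 + Mg j) * U / T := by ring
      have e2 : 2 * k * (1 + ∑ j, Mg j) * (√V / T)
        = 2 * (1 + ∑ j, Mg j) * (k * √V) / T := by ring
      rw [e1, e2]
      have := hMg j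
      gcongr ?_ / _
      calc 2 * (1 + Mg j) * U ≤ 2 * (1 + Mg j) * (k * √V) := by gcongr
        _ ≤ _ := by gcongr
    have h3 : 0 ≤ (2 * Mf * k + k' / 2 + 2 * k * n + C) * (√V / T) := by positivity
    linarith

namespace TAProblem

variable {Ω : Type u} {I J : ℕ} {p : TAProblem Ω I J} {Mf : ℝ} {Mg : Fin J → ℝ}
variable [MeasurableSpace Ω] [Countable Ω] [MeasurableSingletonClass Ω]
  {l : MultVec I J} {S L L' : ℝ}

theorem exists_rate (hp : p.Standing Mf Mg) (hC : 0 < p.driftConst)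
    (hl : p.IsUniqueMultiplier l) (hlnp : p.LocallyNonPolyhedral l S L L') :
    ∃ c V₀ : ℝ, 0 ≤ c ∧ 0 < V₀ ∧ ∀ V : ℝ, V₀ ≤ V →
      SteadyAverages.{u, v} p l L V (fun T gap viol =>
        gap ≤ c * (√V / T + 1 / V) ∧ ∀ j, viol j ≤ c * (√V / T)) := by
  obtain ⟨k, hk, hkU⟩ := (uSmooth_isBigO p.driftConst L).exists_nonneg
  obtain ⟨k', hk', hkU'⟩ := (uSmooth'_isBigO p.driftConst L).exists_nonneg
  have hev : ∀ᶠ V in atTop, 1 ≤ V ∧ bG' p.driftConst L' ≤ S * V ∧ 2 / L' ≤ √V ∧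
      uSmooth p.driftConst L V ≤ k * √V ∧ uSmooth' p.driftConst L V ≤ k' * V := by
    filter_upwards [hkU.bound, hkU'.bound, eventually_ge_atTop 1,
      eventually_ge_atTop (bG' p.driftConst L' / S),
      Real.tendsto_sqrt_atTop.eventually_ge_atTop (2 / L')] with V h1 h2 h3 h4 h5
    rw [div_le_iff₀ hlnp.1, mul_comm] at h4
    rw [Real.norm_of_nonneg (Real.sqrt_nonneg V)] at h1
    rw [Real.norm_of_nonneg (show 0 ≤ V by linarith)] at h2
    exact ⟨h3, h4, h5, (Real.le_norm_self _).trans h1, (Real.le_norm_self _).trans h2⟩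
  obtain ⟨V₀, hV₀⟩ := eventually_atTop.1 hev
  have hMs : 0 ≤ ∑ j, Mg j := Finset.sum_nonneg fun j _ => (hp.Mg_pos j).le
  have hMf := hp.Mf_pos
  refine ⟨2 * Mf * k + k' / 2 + 2 * k * ‖l‖ + p.driftConst + 2 * k * (1 + ∑ j, Mg j),
    max V₀ 1, by positivity, lt_max_of_lt_right one_pos, fun V hV => ?_⟩
  obtain ⟨h1, h2, h3, h4, h5⟩ := hV₀ V ((le_max_left _ _).trans hV)
  exact SteadyAverages.mono (steadyAverages_uSmooth hp hC hl hlnp (by linarith) h2 h3)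
    fun T gap viol hT h => h.rate hT h1 hMf.le (fun j => (hp.Mg_pos j).le) (norm_nonneg _) hC.le
      hk hk' h4 h5

theorem exists_convergence_time (hp : p.Standing Mf Mg) (hC : 0 < p.driftConst)
    (hl : p.IsUniqueMultiplier l) (hlnp : p.LocallyNonPolyhedral l S L L') :
    ∃ c ε₀ : ℝ, 0 < ε₀ ∧ ∀ ε : ℝ, 0 < ε → ε ≤ ε₀ →
      SteadyAverages.{u, v} p l L (1 / ε) (fun T gap viol =>
        ε ^ (-(3 / 2) : ℝ) ≤ (T : ℝ) → gap ≤ c * ε ∧ ∀ j, viol j ≤ c * ε) := by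
  obtain ⟨c, V₀, hc, hV₀, h⟩ := exists_rate.{u, v} hp hC hl hlnp
  -- At V = 1/ε and T ≥ ε^(−3/2) both √V/T and 1/V are at most ε, whence the factor 2.
  refine ⟨2 * c, 1 / V₀, by positivity, fun ε hε hle => ?_⟩
  have hV : V₀ ≤ 1 / ε := (le_one_div hε hV₀).1 hle
  refine SteadyAverages.mono (h (1 / ε) hV) fun T gap viol hT hg hTε => ?_
  have hT0 : (0 : ℝ) < T := by positivity
  have h1 : √(1 / ε) / T ≤ ε := by
    rw [div_le_iff₀ hT0]
    have e : √(1 / ε) = ε * ε ^ (-(3 / 2) : ℝ) := by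
      rw [Real.sqrt_eq_rpow, one_div, Real.inv_rpow hε.le, ← Real.rpow_neg hε.le]
      nth_rewrite 2 [← Real.rpow_one ε]
      rw [← Real.rpow_add hε]
      norm_num
    rw [e]
    exact mul_le_mul_of_nonneg_left hTε hε.le
  have h2 := mul_le_mul_of_nonneg_left h1 hc
  rw [one_div_one_div] at hg
  refine ⟨hg.1.trans (by linarith), fun j => (hg.2 j).trans ?_⟩
  have := mul_nonneg hc hε.le
  linarith

end TAProblem

end

theorem mainTheorem2 :
    ∃ U U' : ℝ → ℝ → ℝ → ℝ,
      (∀ C L : ℝ, 0 < C → 0 < L →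
        (fun V => U C L V) =O[atTop] (fun V => √V) ∧
        (fun V => U' C L V) =O[atTop] (fun V => V)) ∧
      ∀ (Ω : Type u) [Countable Ω] [MeasurableSpace Ω] [MeasurableSingletonClass Ω]
        (I J : ℕ) (_ : 0 < I) (_ : 0 < J) (p : TAProblem Ω I J)
        (Mf : ℝ) (Mg : Fin J → ℝ) (l : MultVec I J) (S L L' : ℝ),
        p.Standing Mf Mg → p.IsUniqueMultiplier l → p.LocallyNonPolyhedral l S L L' →
        -- the bounds for all sufficiently large `V`
        (∀ V : ℝ, 0 < V → bG p.driftConst L V < S * V → bG' p.driftConst L' ≤ S * V →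
          2 / L' ≤ √V →
          SteadyAverages.{u, v} p l L V
            (FormBound Mf Mg p.driftConst ‖l‖ V
              (uG p.driftConst L V) (uG' p.driftConst L V)) ∧
          SteadyAverages.{u, v} p l L V
            (FormBound Mf Mg p.driftConst ‖l‖ V
              (U p.driftConst L V) (U' p.driftConst L V))) ∧
        -- the rates
        (∃ c V₀ : ℝ, 0 < V₀ ∧ ∀ V : ℝ, V₀ ≤ V →
          SteadyAverages.{u, v} p l L V (fun T gap viol =>
            gap ≤ c * (√V / T + 1 / V) ∧ ∀ j, viol j ≤ c * (√V / T))) ∧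
        -- the convergence time
        (∃ c ε₀ : ℝ, 0 < ε₀ ∧ ∀ ε : ℝ, 0 < ε → ε ≤ ε₀ →
          SteadyAverages.{u, v} p l L (1 / ε) (fun T gap viol =>
            ε ^ (-(3 / 2) : ℝ) ≤ (T : ℝ) → gap ≤ c * ε ∧ ∀ j, viol j ≤ c * ε)) := by
  refine ⟨uSmooth, uSmooth', fun C L _ _ => ⟨uSmooth_isBigO C L, uSmooth'_isBigO C L⟩, ?_⟩
  intro Ω _ _ _ I J _ hJ p Mf Mg l S L L' hp hl hlnp
  have hC := hp.driftConst_pos hJ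
  refine ⟨fun V hV _ hB' hsV => ⟨TAProblem.steadyAverages_uG hp hC hl hlnp hV hB' hsV,
    TAProblem.steadyAverages_uSmooth hp hC hl hlnp hV hB' hsV⟩, ?_,
    TAProblem.exists_convergence_time hp hC hl hlnp⟩
  obtain ⟨c, V₀, _, hV₀, h⟩ := TAProblem.exists_rate.{u, v} hp hC hl hlnp
  exact ⟨c, V₀, hV₀, h⟩
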